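/- Let $(X,g)$ be a compact Kähler manifold of dimension $n$ and let $S$ be a complex manifold. Let $F\to X\times S$ be a holomorphic vector bundle with a smooth hermitian metric $h$. For $s\in S$ put $F_s=F|_{X\times\{s\}}$, and let $h_s$ be the restriction of $h$ to $F_s$. Assume that, for every $s\in S$, the metric $h_s$ is Hermite–Einstein with respect to $g$ (that is, $g^{\bar\beta\alpha}R^{h}_{\alpha\bar\beta}|_{X\times\{s\}}=\lambda\cdot\mathrm{id}_{F_s}$ with a real constant $\lambda$) and the bundle $F_s$ is simple (its only holomorphic endomorphisms are the multiples of the identity). Equip $\mathrm{End}(F)$ with the induced hermitian metric $\tilde h(A,B)=\mathrm{tr}(AB^{*})$, where $B^{*}$ is the adjoint of $B$ with respect to $h$. Let $\Omega^{\tilde h}$ be the curvature form of the Chern connection of $(\mathrm{End}(F),\tilde h)$ on $X\times S$. For local holomorphic coordinates $(s^1,\dots,s^m)$ on $S$ put $$\rho_{k\bar l}=\partial_{\bar l}\,\lrcorner\,(\partial_k\,\lrcorner\,\Omega^{\tilde h})=R^{\tilde h}_{k\bar l},$$ restricted to $X\times\{s\}$; this is a smooth section of $\mathrm{End}(\mathrm{End}(F_s))$.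 Let $H(\rho_{k\bar l})(s)$ be its harmonic projection, i.e. its orthogonal projection, for the $L^2$ inner product given by the metric induced by $\tilde h_s$ and by the volume form $\omega^n/n!$ of $g$, to the space of smooth sections of $\mathrm{End}(\mathrm{End}(F_s))$ that are annihilated by the Laplacian $\Box=\bar\partial^{*}\bar\partial$. Then $\tilde h_s$ is a Hermite–Einstein metric on $\mathrm{End}(F_s)$ for every $s\in S$, the traces $\mathrm{tr}(\rho_{k\bar l})$ vanish identically, and $$H(\rho_{k\bar l})(s)=0\qquad\text{for all } s\in S \text{ and all } k,l.$$ (The same holds for the component $\Omega^{\tilde h}(v,\bar w)$ of the curvature for all $v,w\in T_sS$.) Consequently, for every $q\ge 0$ and all $\mathrm{End}(F_s)$-valued $(0,q)$-forms $\xi,\eta$ on $X$ one has $\langle H(\rho_{k\bar l})\,\xi,\eta\rangle=0$; in particular, the summand $\langle H(\rho_{k\bar l})\,\xi_\rho,\xi_\sigma\rangle$ of the curvature formula for the $L^2$ metric on the direct image sheaves $R^qp_*\mathcal O(\mathrm{End}(F))$, where $p:X\times S\to S$ is the projection, vanishes identically. -/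

import Mathlib

open Bundle Set
open scoped Manifold ContDiff ComplexConjugate

noncomputable section

/-! ### Wirtinger derivatives -/

section Wirtinger

variable {E W : Type*} [NormedAddCommGroup E] [NormedSpace ℂ E] [NormedSpace ℝ E]
  [NormedAddCommGroup W] [NormedSpace ℂ W]

/-- The `(1,0)`-derivative `∂_u f (z) = (1/2) (Df_z(u) - i Df_z(iu))`; for `u` the `k`-th coordinate
vector it is `∂f/∂z^k`. -/
def dHol (u : E) (f : E → W) (z : E) : W :=
  (1 / 2 : ℂ) • (fderiv ℝ f z u - Complex.I • fderiv ℝ f z (Complex.I • u))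

/-- The `(0,1)`-derivative `∂̄_w f (z) = (1/2) (Df_z(w) + i Df_z(iw))` (conjugate linear in `w`);
for `w` the `l`-th coordinate vector it is `∂f/∂z̄^l`. -/
def dBar (w : E) (f : E → W) (z : E) : W :=
  (1 / 2 : ℂ) • (fderiv ℝ f z w + Complex.I • fderiv ℝ f z (Complex.I • w))

end Wirtinger

/-! ### Hermitian metrics on a vector bundle -/

/-- A family of sesquilinear forms on the fibres of `E`, linear in the first and conjugate linear in
the second entry. -/
abbrev SesqForm {B : Type*} (E : B → Type*) [∀ p, AddCommGroup (E p)] [∀ p, Module ℂ (E p)] :=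
  ∀ p, E p →ₗ[ℂ] E p →ₗ⋆[ℂ] ℂ

/-- The endomorphism bundle `End(E)`. -/
abbrev EndBundle {B : Type*} (E : B → Type*) [∀ p, AddCommGroup (E p)] [∀ p, Module ℂ (E p)]
    [∀ p, TopologicalSpace (E p)] : B → Type _ :=
  fun p => E p →L[ℂ] E p

section Metric

variable {EB HB B : Type*} [NormedAddCommGroup EB] [NormedSpace ℝ EB] [TopologicalSpace HB]
  [TopologicalSpace B] [ChartedSpace HB B]
  {W : Type*} [NormedAddCommGroup W] [NormedSpace ℂ W]
  {E : B → Type*} [TopologicalSpace (TotalSpace W E)]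
  [∀ p, AddCommGroup (E p)] [∀ p, Module ℂ (E p)] [∀ p, TopologicalSpace (E p)]
  [FiberBundle W E]

/-- A smooth hermitian metric on the complex vector bundle `E`: a family of positive definite
hermitian forms `h p` on the fibres (linear in the first and conjugate linear in the second entry)
whose components in the local frames of the bundle are smooth. Here `IR` is the real model of the
base manifold. -/
structure IsHermitianMetric (IR : ModelWithCorners ℝ EB HB)
    (h : SesqForm E) : Prop where
  conj_symm : ∀ p v w, h p v w = conj (h p w v)
  pos : ∀ p v, v ≠ 0 → 0 < (h p v v).re
  smooth : ∀ (e : Trivialization W (TotalSpace.proj : TotalSpace W E → B))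
    [MemTrivializationAtlas e] (v w : W),
    ContMDiffOn IR 𝓘(ℝ, ℂ) ∞ (fun p => h p (e.symm p v) (e.symm p w)) e.baseSet

/-- The local frame at `q` that is given by the basis `b` of the typical fibre and the preferred
trivialization around `p₀`. -/
def localFrame {ι : Type*} (b : Module.Basis ι ℂ W) (p₀ q : B) (i : ι) : E q :=
  (trivializationAt W E p₀).symm q (b i)

/-- The matrix `h_{i j̄}(q) = h_q(f_i, f_j)` of `h` in the local frame `f` around `p₀`. -/
def gram {ι : Type*} (b : Module.Basis ι ℂ W) (h : SesqForm E) (p₀ q : B) :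
    Matrix ι ι ℂ :=
  Matrix.of fun i j => h q (localFrame (E := E) b p₀ q i) (localFrame (E := E) b p₀ q j)

variable [FiniteDimensional ℂ W] [∀ p, IsTopologicalAddGroup (E p)] [∀ p, ContinuousSMul ℂ (E p)]

variable (W) in
/-- The hermitian form induced by `h` on the endomorphism bundle,
`⟨A, B⟩ = tr (A ∘ B^*) = ∑ h^{j̄ i} h(A f_i, B f_j)` for an arbitrary frame `f`, where `h^{j̄ i}` is
the inverse of the matrix `h_{i j̄}` and `B^*` is the `h`-adjoint of `B`. -/
def endForm (h : SesqForm E) : SesqForm (EndBundle E) := fun p =>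
  let b := Module.finBasis ℂ W
  let f : Fin (Module.finrank ℂ W) → E p := localFrame b p p
  LinearMap.mk₂'ₛₗ (RingHom.id ℂ) (starRingEnd ℂ)
    (fun A B => ∑ i, ∑ j, (gram b h p p)⁻¹ j i * h p (A (f i)) (B (f j)))
    (by intro A A' B; simp [mul_add, Finset.sum_add_distrib])
    (by intro c A B; simp [Finset.mul_sum, mul_left_comm])
    (by intro A B B'; simp [mul_add, Finset.sum_add_distrib])
    (by intro c A B; simp [Finset.mul_sum, mul_left_comm])

end Metric

/-! ### The curvature form of the Chern connection -/

section Curvature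

variable {EB HB B : Type*} [NormedAddCommGroup EB] [NormedSpace ℂ EB] [NormedSpace ℝ EB]
  [TopologicalSpace HB] [TopologicalSpace B] [ChartedSpace HB B]
  {W : Type*} [NormedAddCommGroup W] [NormedSpace ℂ W] [FiniteDimensional ℂ W]
  {E : B → Type*} [TopologicalSpace (TotalSpace W E)]
  [∀ p, AddCommGroup (E p)] [∀ p, Module ℂ (E p)] [∀ p, TopologicalSpace (E p)]
  [FiberBundle W E]

/-- The matrix `h_{i j̄}` of `h` around `p₀`, as a function of the holomorphic coordinates. -/
def localMatrix (I : ModelWithCorners ℂ EB HB) (h : SesqForm E) (p₀ : B) (z : EB) :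
    Matrix (Fin (Module.finrank ℂ W)) (Fin (Module.finrank ℂ W)) ℂ :=
  gram (Module.finBasis ℂ W) h p₀ ((extChartAt I p₀).symm z)

/-- The connection form `θ_u = ∂_u h · h⁻¹` of the Chern connection in the holomorphic frame around
`p₀`, i.e. `∇_u f_i = ∑ j, (θ_u)_{i j} f_j`. -/
def connectionMatrix (I : ModelWithCorners ℂ EB HB) (h : SesqForm E) (p₀ : B)
    (u z : EB) : Matrix (Fin (Module.finrank ℂ W)) (Fin (Module.finrank ℂ W)) ℂ :=
  (Matrix.of fun i j => dHol u (fun z' => localMatrix I h p₀ z' i j) z) * (localMatrix I h p₀ z)⁻¹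

/-- The components `R_{u w̄} = - ∂̄_w θ_u` of the curvature at the point `p₀`. -/
def curvatureMatrix (I : ModelWithCorners ℂ EB HB) (h : SesqForm E) (p₀ : B)
    (u w : EB) : Matrix (Fin (Module.finrank ℂ W)) (Fin (Module.finrank ℂ W)) ℂ :=
  Matrix.of fun i j =>
    - dBar w (fun z => connectionMatrix I h p₀ u z i j) (extChartAt I p₀ p₀)

variable (W) in
/-- The curvature form `Ω(u, w̄) = R_{u w̄}` of `h` at `p`, as an endomorphism of the fibre `E p`
(it sends `f_i` to `∑ j, R_{i j} f_j`). The `(1,0)`-vectors `u`, `w` at `p` are given by their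
components in the preferred chart at `p`, that is, as elements of Mathlib's tangent space. -/
def chernCurvature [VectorBundle ℂ W E] (I : ModelWithCorners ℂ EB HB)
    (h : SesqForm E) (p : B) (u w : TangentSpace I p) : E p →L[ℂ] E p :=
  ((trivializationAt W E p).symmL ℂ p).comp
    ((LinearMap.toContinuousLinearMap
      (Matrix.toLin (Module.finBasis ℂ W) (Module.finBasis ℂ W)
        (curvatureMatrix I h p u w).transpose)).comp
      ((trivializationAt W E p).continuousLinearMapAt ℂ p))

end Curvature

/-! ### The compact Kähler manifold `X` -/

/-- A family of sesquilinear forms on the holomorphic tangent spaces of an `n`-dimensional complex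
manifold `X`. -/
abbrev TangentForm (n : ℕ) (X : Type*) [TopologicalSpace X] [ChartedSpace (Fin n → ℂ) X] :=
  SesqForm (fun x : X => TangentSpace 𝓘(ℂ, Fin n → ℂ) x)

section Base

variable {n : ℕ} {X : Type*} [TopologicalSpace X] [ChartedSpace (Fin n → ℂ) X]

section Partition

variable [CompactSpace X] [T2Space X]

variable (n X) in
theorem exists_chart_partition : ∃ f : PartitionOfUnity X X (univ : Set X),
    f.IsSubordinate fun x => (chartAt (Fin n → ℂ) x).source :=
  PartitionOfUnity.exists_isSubordinate isClosed_univ _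
    (fun x => (chartAt (Fin n → ℂ) x).open_source)
    (fun x _ => mem_iUnion.2 ⟨x, mem_chart_source _ x⟩)

variable (n X) in
/-- A partition of unity subordinate to the preferred charts. -/
def chartPartition : PartitionOfUnity X X (univ : Set X) :=
  Classical.choose (exists_chart_partition n X)

end Partition

variable [IsManifold 𝓘(ℂ, Fin n → ℂ) ω X]

/-- The matrix `g_{α β̄}(y)` of a hermitian form on `TX` in the chart around `x`. -/
def coordMetric (g : TangentForm n X) (x y : X) : Matrix (Fin n) (Fin n) ℂ :=
  gram (E := (TangentSpace 𝓘(ℂ, Fin n → ℂ) : X → Type)) (Pi.basisFun ℂ (Fin n)) g x y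

/-- The Kähler condition `dω = 0` for `ω = (i/2) g_{α β̄} dz^α ∧ dz̄^β`, in coordinates:
`∂_γ g_{α β̄} = ∂_α g_{γ β̄}`. -/
def IsKaehler (g : TangentForm n X) : Prop :=
  ∀ x : X, ∀ z ∈ (chartAt (Fin n → ℂ) x).target, ∀ α β γ : Fin n,
    dHol (Pi.single γ 1) (fun z' => coordMetric g x ((chartAt (Fin n → ℂ) x).symm z') α β) z =
      dHol (Pi.single α 1) (fun z' => coordMetric g x ((chartAt (Fin n → ℂ) x).symm z') γ β) z

/-- The integral `∫_X f ω^n / n!`: in a chart the volume form is `det (g_{α β̄})` times the Lebesgue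
measure, and the contributions of the charts are added up by means of a partition of unity. -/
def kaehlerIntegral [CompactSpace X] [T2Space X] (g : TangentForm n X) (f : X → ℂ) : ℂ :=
  ∑ᶠ x : X, ∫ z in (chartAt (Fin n → ℂ) x).target,
    (chartPartition n X x ((chartAt (Fin n → ℂ) x).symm z) : ℂ) *
      f ((chartAt (Fin n → ℂ) x).symm z) *
      (coordMetric g x ((chartAt (Fin n → ℂ) x).symm z)).det

end Base

/-! ### Families of bundles on `X` parameterized by `S` -/

section Family

variable {n m : ℕ} {X S : Type*} [TopologicalSpace X] [ChartedSpace (Fin n → ℂ) X]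
  [IsManifold 𝓘(ℂ, Fin n → ℂ) ω X]
  [TopologicalSpace S] [ChartedSpace (Fin m → ℂ) S]
  {W : Type*} [NormedAddCommGroup W] [NormedSpace ℂ W]
  {E : X × S → Type*} [TopologicalSpace (TotalSpace W E)]
  [∀ p, AddCommGroup (E p)] [∀ p, Module ℂ (E p)] [∀ p, TopologicalSpace (E p)]
  [FiberBundle W E]

variable (n m W) in
/-- `η` is a smooth section of `E_s = E | X × {s}`. -/
def IsSmoothSection (s : S) (η : ∀ x : X, E (x, s)) : Prop :=
  ContMDiff 𝓘(ℝ, Fin n → ℂ) ((𝓘(ℝ, Fin n → ℂ).prod 𝓘(ℝ, Fin m → ℂ)).prod 𝓘(ℝ, W)) ∞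
    (fun x => (⟨(x, s), η x⟩ : TotalSpace W E))

variable (n m W) in
/-- `η` is a holomorphic section of `E_s = E | X × {s}`. -/
def IsHolomorphicSection (s : S) (η : ∀ x : X, E (x, s)) : Prop :=
  MDifferentiable 𝓘(ℂ, Fin n → ℂ) ((𝓘(ℂ, Fin n → ℂ).prod 𝓘(ℂ, Fin m → ℂ)).prod 𝓘(ℂ, W))
    (fun x => (⟨(x, s), η x⟩ : TotalSpace W E))

variable (W) in
/-- The components `(∂̄η)_{β̄}` at `x`, in the chart at `x`, of the `E_s`-valued `(0,1)`-form `∂̄η`,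
for a section `η` of `E_s`. -/
def dbarSection (s : S) (η : ∀ x : X, E (x, s)) (x : X) (β : Fin n) : E (x, s) :=
  (trivializationAt W E (x, s)).symm (x, s)
    (dBar (Pi.single β 1)
      (fun z => (trivializationAt W E (x, s)
        ⟨((chartAt (Fin n → ℂ) x).symm z, s), η ((chartAt (Fin n → ℂ) x).symm z)⟩).2)
      (chartAt (Fin n → ℂ) x x))

variable (n m W E) in
/-- `E_s` is simple: the holomorphic endomorphisms of `E_s` are the multiples of the identity. -/
def IsSimpleFibre [VectorBundle ℂ W E] [∀ p, IsTopologicalAddGroup (E p)]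
    [∀ p, ContinuousSMul ℂ (E p)] (s : S) : Prop :=
  ∀ A : ∀ x : X, E (x, s) →L[ℂ] E (x, s),
    IsHolomorphicSection n m (W →L[ℂ] W) (E := EndBundle E) s A →
      ∃ c : ℂ, ∀ x, A x = c • ContinuousLinearMap.id ℂ (E (x, s))

variable (m W) in
/-- `h_s` is a Hermite-Einstein metric on `E_s`: `g^{β̄ α} R_{α β̄} = λ · id` with a real constant
`λ`. -/
def IsHermiteEinstein [FiniteDimensional ℂ W] [VectorBundle ℂ W E] [∀ p, IsTopologicalAddGroup (E p)]
    [∀ p, ContinuousSMul ℂ (E p)]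
    (g : TangentForm n X)
    (h : SesqForm E) (s : S) : Prop :=
  ∃ l : ℝ, ∀ x : X,
    ∑ α : Fin n, ∑ β : Fin n, (coordMetric g x x)⁻¹ β α •
      chernCurvature W (𝓘(ℂ, Fin n → ℂ).prod 𝓘(ℂ, Fin m → ℂ)) h (x, s)
        ((Pi.single α 1, 0) : (Fin n → ℂ) × (Fin m → ℂ))
        ((Pi.single β 1, 0) : (Fin n → ℂ) × (Fin m → ℂ)) =
      (l : ℂ) • ContinuousLinearMap.id ℂ (E (x, s))

variable (n W) in
/-- The section `ρ_{v w̄} = Ω^h(v, w̄)` of `End(E_s)`, for tangent vectors `v`, `w` of `S` at `s`. If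
`v = ∂_k` and `w = ∂_l` in local coordinates of `S`, this is
`ρ_{k l̄} = ∂_l̄ ⌟ (∂_k ⌟ Ω^h) = R^h_{k l̄}`. -/
def baseCurvature [FiniteDimensional ℂ W] [VectorBundle ℂ W E]
    (h : SesqForm E) (s : S) (v w : TangentSpace 𝓘(ℂ, Fin m → ℂ) s) (x : X) :
    E (x, s) →L[ℂ] E (x, s) :=
  chernCurvature W (𝓘(ℂ, Fin n → ℂ).prod 𝓘(ℂ, Fin m → ℂ)) h (x, s)
    ((0, v) : (Fin n → ℂ) × (Fin m → ℂ)) ((0, w) : (Fin n → ℂ) × (Fin m → ℂ))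

variable [CompactSpace X] [T2Space X]

/-- The `L²` inner product `∫_X (ξ, η) ω^n / n!` of `E_s`-valued `(0,q)`-forms
`ξ = (1/q!) ∑ ξ_{β̄_1 … β̄_q} dz̄^{β_1} ∧ … ∧ dz̄^{β_q}`, where at `x` the components refer to the chart
at `x`, and `(ξ, η) = (1/q!) ∑ g^{β̄_1 α_1} ⋯ g^{β̄_q α_q} h(ξ_{β̄_1 … β̄_q}, η_{ᾱ_1 … ᾱ_q})`. -/
def l2Product
    (g : TangentForm n X)
    (h : SesqForm E) (s : S) {q : ℕ}
    (ξ η : ∀ x : X, (Fin q → Fin n) → E (x, s)) : ℂ :=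
  kaehlerIntegral g fun x =>
    (1 / (q.factorial : ℂ)) * ∑ b : Fin q → Fin n, ∑ a : Fin q → Fin n,
      (∏ i, (coordMetric g x x)⁻¹ (b i) (a i)) * h (x, s) (ξ x b) (η x a)

/-- The `L²` inner product of sections of `E_s`, i.e. of `(0,0)`-forms. -/
def l2Section
    (g : TangentForm n X)
    (h : SesqForm E) (s : S) (σ η : ∀ x : X, E (x, s)) : ℂ :=
  l2Product g h s (q := 0) (fun x _ => σ x) (fun x _ => η x)

variable (m W) in
/-- The section `τ` is `□ η = ∂̄^* ∂̄ η`, where `∂̄^*` is the formal adjoint of `∂̄`. -/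
def IsLaplacian
    (g : TangentForm n X)
    (h : SesqForm E) (s : S) (η τ : ∀ x : X, E (x, s)) : Prop :=
  IsSmoothSection n m W s τ ∧ ∀ ζ : ∀ x : X, E (x, s), IsSmoothSection n m W s ζ →
    l2Section g h s τ ζ =
      l2Product g h s (q := 1) (fun x b => dbarSection W s η x (b 0))
        (fun x b => dbarSection W s ζ x (b 0))

variable (m W) in
/-- `η` is a harmonic section of `E_s`, i.e. a smooth section with `□ η = 0`. -/
def IsHarmonicSection
    (g : TangentForm n X)
    (h : SesqForm E) (s : S) (η : ∀ x : X, E (x, s)) : Prop :=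
  IsSmoothSection n m W s η ∧ IsLaplacian m W g h s η (fun _ => 0)

variable (m W) in
/-- `σ = H(τ)` is the harmonic projection of the section `τ` of `E_s`, i.e. the `L²`-orthogonal
projection of `τ` to the space of harmonic sections. -/
def IsHarmonicProjection
    (g : TangentForm n X)
    (h : SesqForm E) (s : S) (τ σ : ∀ x : X, E (x, s)) : Prop :=
  IsHarmonicSection m W g h s σ ∧
    ∀ η : ∀ x : X, E (x, s), IsHarmonicSection m W g h s η →
      l2Section g h s (fun x => τ x - σ x) η = 0

variable (m W) in
/-- `σ = H(ρ_{v w̄})(s)`: the fibrewise harmonic projection, a section of `End(E_s)`, of the curvature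
component `ρ_{v w̄}` of the family `(E, h)`, where `End(E_s)` carries the metric induced by `h_s`. -/
def IsHarmonicCurvatureTerm [FiniteDimensional ℂ W] [VectorBundle ℂ W E]
    [∀ p, IsTopologicalAddGroup (E p)] [∀ p, ContinuousSMul ℂ (E p)]
    (g : TangentForm n X) (h : SesqForm E) (s : S) (v w : TangentSpace 𝓘(ℂ, Fin m → ℂ) s)
    (σ : ∀ x : X, EndBundle E (x, s)) : Prop :=
  IsHarmonicProjection m (W →L[ℂ] W) (E := EndBundle E) g (endForm W h) s
    (baseCurvature n W h s v w) σ

end Family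

end

/-! Everything follows from the fact that the curvature of `End(F)` acts by commutators: if `R` is
the curvature component of `F`, then the component of `End(F)` is `ad R : A ↦ RA - AR`
(`chernCurvature_endForm`). Commutators have trace zero as operators (`trace_adLinear`). Contracting
with `g` commutes with `ad`, so the Hermite–Einstein equation on `F_s` turns into `ad(λ id) = 0` on
`End(F_s)`.

For the harmonic projection, let `η` be a harmonic section of `End(End(F_s))`. Testing `□η = 0` with
`η` gives `‖∂̄η‖² = 0`, so `η` is holomorphic. The trace pairing dualizes `ad` to a linear map
`endContraction` from `End(End(F_s))` to `End(F_s)`, determined by `tr(R ∘ endContraction η) = tr(ad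
R ∘ η)`. It is natural in the fibre, hence constant in every trivialization, and sends `η` to a
holomorphic endomorphism of `F_s`. Simplicity makes this endomorphism `c · id`. Taking `R = id`,
where `ad R = 0`, gives `c · rank = 0`; hence `tr(ad R ∘ η) = 0` for all `R`
(`trace_adLinear_comp_eq_zero`).

Since `(ad R)^* = ad(R^*)` for the induced metric (`endForm_adLinear`), this says that `ad R` is
orthogonal to `η` at every point, not only after integration (`endForm_endForm_eq_zero`). The
curvature component is such an `ad R` at each point, so it is orthogonal to all harmonic sections
and its projection is zero (`isHarmonicProjection_iff_eq_zero`). -/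

noncomputable section

/-! ### Linear algebra of positive hermitian forms and their contractions -/

section PosHermitian

variable {T : Type*} [AddCommGroup T] [Module ℂ T]

/-- A positive definite hermitian form on a complex vector space. -/
structure IsPosHermitian (h : T →ₗ[ℂ] T →ₗ⋆[ℂ] ℂ) : Prop where
  conj_symm : ∀ v w, h v w = conj (h w v)
  pos : ∀ v, v ≠ 0 → 0 < (h v v).re

/-- The matrix of a sesquilinear form with respect to a family of vectors. -/
def formMatrix {ι : Type*} (f : ι → T) (M : T →ₗ[ℂ] T →ₗ⋆[ℂ] ℂ) : Matrix ι ι ℂ :=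
  Matrix.of fun i j => M (f i) (f j)

/-- The contraction `∑ h^{j̄ i} M_{i j̄}` of a sesquilinear form `M` by `h` in the frame `f`. -/
def contraction {ι : Type*} [Fintype ι] [DecidableEq ι] (h M : T →ₗ[ℂ] T →ₗ⋆[ℂ] ℂ)
    (f : ι → T) : ℂ :=
  ∑ i, ∑ j, (formMatrix f h)⁻¹ j i * M (f i) (f j)

variable {h : T →ₗ[ℂ] T →ₗ⋆[ℂ] ℂ} {ι : Type*} [Fintype ι] [DecidableEq ι]

theorem contraction_eq_trace_mul (h M : T →ₗ[ℂ] T →ₗ⋆[ℂ] ℂ) (f : ι → T) :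
    contraction h M f = ((formMatrix f h)⁻¹ * formMatrix f M).trace := by
  rw [contraction, Finset.sum_comm]
  simp [Matrix.trace, Matrix.mul_apply, formMatrix]

theorem IsPosHermitian.eq_zero (hh : IsPosHermitian h) {v : T} (hv : ∀ w, h v w = 0) : v = 0 := by
  by_contra hne
  have := hh.pos v hne
  simp [hv v] at this

theorem IsPosHermitian.self_nonneg (hh : IsPosHermitian h) (v : T) : 0 ≤ (h v v).re := by
  rcases eq_or_ne v 0 with rfl | hv
  · simp
  · exact (hh.pos v hv).le

theorem IsPosHermitian.self_eq_re (hh : IsPosHermitian h) (v : T) :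
    h v v = ((h v v).re : ℂ) := by
  have := hh.conj_symm v v
  exact (Complex.conj_eq_iff_real.1 this.symm).elim fun r hr => by rw [hr]; simp

theorem IsPosHermitian.self_eq_zero (hh : IsPosHermitian h) {v : T} (hv : (h v v).re = 0) :
    v = 0 := by
  by_contra hne
  exact (hh.pos v hne).ne' hv

theorem IsPosHermitian.exists_orthonormal_basis [FiniteDimensional ℂ T] (hh : IsPosHermitian h) :
    ∃ b : Module.Basis (Fin (Module.finrank ℂ T)) ℂ T,
      ∀ i j, h (b i) (b j) = if i = j then 1 else 0 := by
  let core : InnerProductSpace.Core ℂ T :=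
    -- The arguments are swapped because `inner` is conjugate linear in the first entry, while `h`
    -- is so in the second.
    { inner := fun x y => h y x
      conj_inner_symm := fun x y => (hh.conj_symm y x).symm
      re_inner_nonneg := fun x => hh.self_nonneg x
      add_left := fun x y z => by simp
      smul_left := fun x y r => by simp
      definite := fun x hx => hh.self_eq_zero (by rw [hx]; simp) }
  let _ : NormedAddCommGroup T := core.toNormedAddCommGroup
  let _ : InnerProductSpace ℂ T := InnerProductSpace.ofCore core.toCore
  refine ⟨(stdOrthonormalBasis ℂ T).toBasis, fun i j => ?_⟩
  have := orthonormal_iff_ite.1 (stdOrthonormalBasis ℂ T).orthonormal j i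
  rw [OrthonormalBasis.coe_toBasis]
  exact this.trans (by simp [eq_comm])

open scoped ComplexOrder in
theorem formMatrix_posDef (hh : IsPosHermitian h) (b : Module.Basis ι ℂ T) :
    (formMatrix b h).PosDef := by
  refine Matrix.PosDef.of_dotProduct_mulVec_pos ?_ ?_
  · ext i j
    simp only [formMatrix, Matrix.conjTranspose_apply, Matrix.of_apply]
    exact (hh.conj_symm _ _).symm
  · intro x hx
    -- Linearity of `h` in the first entry means that `x^* H x` is the square norm of the vector
    -- whose coefficients are the conjugates of those of `x`.
    have key : star x ⬝ᵥ (formMatrix b h).mulVec x =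
        h (∑ i, conj (x i) • b i) (∑ i, conj (x i) • b i) := by
      simp [dotProduct, Matrix.mulVec, formMatrix, Finset.mul_sum, mul_comm]
      rw [Finset.sum_comm]
      refine Finset.sum_congr rfl fun i _ => ?_
      rw [Finset.sum_mul]
      exact Finset.sum_congr rfl fun j _ => by ring
    have hne : (∑ i, conj (x i) • b i) ≠ 0 := by
      intro h0
      apply hx
      have := Fintype.linearIndependent_iff.1 b.linearIndependent _ h0
      funext i
      simpa using this i
    rw [key, hh.self_eq_re]
    exact_mod_cast hh.pos _ hne

open scoped ComplexOrder in
theorem isUnit_det_formMatrix (hh : IsPosHermitian h) (b : Module.Basis ι ℂ T) :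
    IsUnit (formMatrix b h).det :=
  (formMatrix_posDef hh b).det_pos.ne'.isUnit

theorem formMatrix_toLin (b : Module.Basis ι ℂ T) (h : T →ₗ[ℂ] T →ₗ⋆[ℂ] ℂ) (A : T →ₗ[ℂ] T) :
    formMatrix b (h ∘ₗ A) = (LinearMap.toMatrix b b A).transpose * formMatrix b h := by
  ext i j
  simp only [formMatrix, Matrix.of_apply, LinearMap.comp_apply, Matrix.mul_apply,
    Matrix.transpose_apply]
  conv_lhs => rw [← b.sum_repr (A (b i))]
  simp [LinearMap.toMatrix_apply, -Module.Basis.sum_repr]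

/-- Nondegeneracy of `h`: with respect to a basis the representing operator has the matrix `(M
H⁻¹)ᵀ`. It gives the contraction a meaning without a basis, and it also provides adjoints. -/
theorem exists_form_eq_comp (hh : IsPosHermitian h) (b : Module.Basis ι ℂ T)
    (M : T →ₗ[ℂ] T →ₗ⋆[ℂ] ℂ) : ∃ A : T →ₗ[ℂ] T, ∀ x y, M x y = h (A x) y := by
  let A := Matrix.toLin b b (formMatrix b M * (formMatrix b h)⁻¹).transpose
  have key : formMatrix b (h ∘ₗ A) = formMatrix b M := by
    rw [formMatrix_toLin, LinearMap.toMatrix_toLin, Matrix.transpose_transpose,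
      Matrix.nonsing_inv_mul_cancel_right _ _ (isUnit_det_formMatrix hh b)]
  refine ⟨A, fun x y => ?_⟩
  have : M = h ∘ₗ A := b.ext fun i => b.ext fun j => (congrFun (congrFun key i) j).symm
  rw [this]; rfl

theorem contraction_eq_trace (hh : IsPosHermitian h) (b : Module.Basis ι ℂ T)
    {M : T →ₗ[ℂ] T →ₗ⋆[ℂ] ℂ} {A : T →ₗ[ℂ] T} (hA : ∀ x y, M x y = h (A x) y) :
    contraction h M b = LinearMap.trace ℂ T A := by
  have : M = h ∘ₗ A := by ext x y; exact hA x y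
  rw [contraction_eq_trace_mul, this, formMatrix_toLin, Matrix.trace_mul_comm, Matrix.mul_assoc,
    Matrix.mul_nonsing_inv _ (isUnit_det_formMatrix hh b), mul_one, Matrix.trace_transpose,
    LinearMap.trace_eq_matrix_trace ℂ b]

/-- Both sides are the trace of the operator that represents `M` by `h`. This is what allows a
change of frame or chart in all later definitions that fix one. -/
theorem contraction_congr_basis {κ : Type*} [Fintype κ] [DecidableEq κ] (hh : IsPosHermitian h)
    (b : Module.Basis ι ℂ T) (b' : Module.Basis κ ℂ T) (M : T →ₗ[ℂ] T →ₗ⋆[ℂ] ℂ) :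
    contraction h M b = contraction h M b' := by
  obtain ⟨A, hA⟩ := exists_form_eq_comp hh b M
  rw [contraction_eq_trace hh b hA, contraction_eq_trace hh b' hA]

/-- In an `h`-orthonormal basis the Gram matrix is the identity. One basis serves all `M`, and it
makes positivity and reality of contractions visible. -/
theorem exists_contraction_eq_sum (hh : IsPosHermitian h) (b : Module.Basis ι ℂ T) :
    ∃ b' : Module.Basis (Fin (Module.finrank ℂ T)) ℂ T,
      ∀ M : T →ₗ[ℂ] T →ₗ⋆[ℂ] ℂ, contraction h M b = ∑ i, M (b' i) (b' i) := by
  have := b.finiteDimensional_of_finite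
  obtain ⟨b', hb'⟩ := hh.exists_orthonormal_basis
  refine ⟨b', fun M => ?_⟩
  have h1 : formMatrix b' h = 1 := by
    ext i j
    simp [formMatrix, hb', Matrix.one_apply]
  rw [contraction_congr_basis hh b b', contraction_eq_trace_mul, h1]
  simp [Matrix.trace, formMatrix]

theorem contraction_conj (hh : IsPosHermitian h) (b : Module.Basis ι ℂ T)
    {M M' : T →ₗ[ℂ] T →ₗ⋆[ℂ] ℂ} (hM : ∀ x y, M x y = conj (M' y x)) :
    contraction h M b = conj (contraction h M' b) := by
  obtain ⟨b', hb'⟩ := exists_contraction_eq_sum hh b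
  rw [hb', hb', map_sum]
  exact Finset.sum_congr rfl fun i _ => hM _ _

theorem IsPosHermitian.exists_adjoint [FiniteDimensional ℂ T] (hh : IsPosHermitian h)
    (B : T →ₗ[ℂ] T) : ∃ C : T →ₗ[ℂ] T, ∀ x y, h x (B y) = h (C x) y :=
  exists_form_eq_comp hh (Module.finBasis ℂ T)
    (LinearMap.mk₂'ₛₗ (RingHom.id ℂ) (starRingEnd ℂ) (fun x y => h x (B y))
      (by simp) (by simp) (by simp) (by simp))

/-- The form `(x, y) ↦ h (A x) (B y)`. -/
def formComp {T' : Type*} [AddCommGroup T'] [Module ℂ T'] (h : T' →ₗ[ℂ] T' →ₗ⋆[ℂ] ℂ)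
    (A B : T →ₗ[ℂ] T') : T →ₗ[ℂ] T →ₗ⋆[ℂ] ℂ :=
  LinearMap.mk₂'ₛₗ (RingHom.id ℂ) (starRingEnd ℂ) (fun x y => h (A x) (B y))
    (by simp) (by simp) (by simp) (by simp)

/-- The form `(x, y) ↦ h (A y) (A x)` for a conjugate linear map `A`. -/
def formConjComp {T' : Type*} [AddCommGroup T'] [Module ℂ T'] (h : T' →ₗ[ℂ] T' →ₗ⋆[ℂ] ℂ)
    (A : T →ₗ⋆[ℂ] T') : T →ₗ[ℂ] T →ₗ⋆[ℂ] ℂ :=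
  LinearMap.mk₂'ₛₗ (RingHom.id ℂ) (starRingEnd ℂ) (fun x y => h (A y) (A x))
    (by simp) (by simp) (by simp) (by simp)

@[simp] theorem formComp_apply {T' : Type*} [AddCommGroup T'] [Module ℂ T']
    (h : T' →ₗ[ℂ] T' →ₗ⋆[ℂ] ℂ) (A B : T →ₗ[ℂ] T') (x y : T) :
    formComp h A B x y = h (A x) (B y) := rfl

end PosHermitian

end

noncomputable section

/-! ### Smooth dependence of the inverse matrix -/

section MatrixSmooth

variable {ι : Type*} [Fintype ι] [DecidableEq ι] {k : WithTop ℕ∞}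

theorem contDiff_matrix_det {V : Type*} [NormedAddCommGroup V] [NormedSpace ℝ V]
    {M : V → Matrix ι ι ℂ} (hM : ∀ i j, ContDiff ℝ k fun v => M v i j) :
    ContDiff ℝ k fun v => (M v).det := by
  simp only [Matrix.det_apply']
  exact ContDiff.sum fun σ _ => contDiff_const.mul (contDiff_prod fun i _ => hM _ _)

/-- Cramer's rule: an entry of the inverse is a cofactor, polynomial in the entries, divided by the
determinant. -/
theorem contDiffAt_matrix_inv_apply {N : ι → ι → ℂ} (hN : (Matrix.of N).det ≠ 0) (i j : ι) :
    ContDiffAt ℝ k (fun N : ι → ι → ℂ => (Matrix.of N)⁻¹ i j) N := by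
  simp only [Matrix.inv_def, Ring.inverse_eq_inv, Matrix.smul_apply, smul_eq_mul]
  have hdet : ContDiff ℝ k fun N : ι → ι → ℂ => (Matrix.of N).det :=
    contDiff_matrix_det fun i j => by dsimp; fun_prop
  refine (hdet.contDiffAt.inv hN).mul (ContDiff.contDiffAt ?_)
  simp only [Matrix.adjugate_apply]
  refine contDiff_matrix_det fun a b => ?_
  by_cases h : a = j
  · subst h
    simp only [Matrix.updateRow_self]
    exact contDiff_const
  · simp only [Matrix.updateRow_ne h]
    dsimp; fun_prop

end MatrixSmooth

/-! ### Frames of the fibres and trivializations of the endomorphism bundle -/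

section TrivializationBasis

variable {B : Type*} [TopologicalSpace B] {W : Type*} [NormedAddCommGroup W] [NormedSpace ℂ W]
  {E : B → Type*} [TopologicalSpace (TotalSpace W E)]
  [∀ p, AddCommGroup (E p)] [∀ p, Module ℂ (E p)] [∀ p, TopologicalSpace (E p)]
  [FiberBundle W E] [VectorBundle ℂ W E] {ι : Type*}

/-- The basis of the fibre that a trivialization gives. -/
def fibreBasis (b : Module.Basis ι ℂ W) (e : Trivialization W (TotalSpace.proj : TotalSpace W E → B))
    [MemTrivializationAtlas e] {p : B} (hp : p ∈ e.baseSet) : Module.Basis ι ℂ (E p) :=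
  b.map (e.linearEquivAt ℂ p hp).symm

@[simp] theorem fibreBasis_apply (b : Module.Basis ι ℂ W)
    (e : Trivialization W (TotalSpace.proj : TotalSpace W E → B)) [MemTrivializationAtlas e] {p : B}
    (hp : p ∈ e.baseSet) (i : ι) : fibreBasis b e hp i = e.symm p (b i) := by
  simp [fibreBasis]

theorem finiteDimensional_fibre (b : Module.Basis ι ℂ W) [Finite ι] (p : B) :
    FiniteDimensional ℂ (E p) :=
  (fibreBasis b (trivializationAt W E p)
    (mem_baseSet_trivializationAt W E p)).finiteDimensional_of_finite

theorem t2Space_fibre (e : Trivialization W (TotalSpace.proj : TotalSpace W E → B))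
    [MemTrivializationAtlas e] {p : B} (hp : p ∈ e.baseSet) : T2Space (E p) :=
  (e.continuousLinearEquivAt ℂ p hp).toHomeomorph.symm.t2Space

variable [∀ p, IsTopologicalAddGroup (E p)] [∀ p, ContinuousSMul ℂ (E p)]

theorem Bundle.Trivialization.continuousLinearMap_symm_eq
    (e e' : Trivialization W (TotalSpace.proj : TotalSpace W E → B))
    [MemTrivializationAtlas e] [MemTrivializationAtlas e'] {p : B}
    (hp : p ∈ e.baseSet ∩ e'.baseSet) (A : W →L[ℂ] W) :
    (e.continuousLinearMap (RingHom.id ℂ) e').symm p A =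
      (e'.symmL ℂ p).comp (A.comp (e.continuousLinearMapAt ℂ p)) := by
  rw [Trivialization.symm_apply _ hp]
  rfl

theorem Bundle.Trivialization.continuousLinearMap_continuousLinearMapAt_eq
    (e e' : Trivialization W (TotalSpace.proj : TotalSpace W E → B))
    [MemTrivializationAtlas e] [MemTrivializationAtlas e'] {p : B}
    (hp : p ∈ e.baseSet ∩ e'.baseSet) (A : E p →L[ℂ] E p) :
    (e.continuousLinearMap (RingHom.id ℂ) e').continuousLinearMapAt ℂ p A =
      (e'.continuousLinearMapAt ℂ p).comp (A.comp (e.symmL ℂ p)) := by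
  rw [Trivialization.continuousLinearMapAt_apply, Trivialization.coe_linearMapAt_of_mem _ hp]
  rfl

theorem endBundle_symm_eq (p₀ : B) {p : B} (hp : p ∈ (trivializationAt W E p₀).baseSet)
    (A : W →L[ℂ] W) :
    (trivializationAt (W →L[ℂ] W) (EndBundle E) p₀).symm p A =
      ((trivializationAt W E p₀).symmL ℂ p).comp
        (A.comp ((trivializationAt W E p₀).continuousLinearMapAt ℂ p)) :=
  Trivialization.continuousLinearMap_symm_eq _ _ ⟨hp, hp⟩ A

theorem endBundle_symmL_eq (p₀ : B) {p : B} (hp : p ∈ (trivializationAt W E p₀).baseSet)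
    (A : W →L[ℂ] W) :
    (trivializationAt (W →L[ℂ] W) (EndBundle E) p₀).symmL ℂ p A =
      ((trivializationAt W E p₀).symmL ℂ p).comp
        (A.comp ((trivializationAt W E p₀).continuousLinearMapAt ℂ p)) :=
  (Trivialization.symmL_apply (trivializationAt (W →L[ℂ] W) (EndBundle E) p₀)
    (show p ∈ (trivializationAt (W →L[ℂ] W) (EndBundle E) p₀).baseSet from ⟨hp, hp⟩) _).trans (endBundle_symm_eq p₀ hp A)

theorem endBundle_continuousLinearMapAt_eq (p₀ : B) {p : B}
    (hp : p ∈ (trivializationAt W E p₀).baseSet) (A : E p →L[ℂ] E p) :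
    (trivializationAt (W →L[ℂ] W) (EndBundle E) p₀).continuousLinearMapAt ℂ p A =
      ((trivializationAt W E p₀).continuousLinearMapAt ℂ p).comp
        (A.comp ((trivializationAt W E p₀).symmL ℂ p)) :=
  Trivialization.continuousLinearMap_continuousLinearMapAt_eq _ _ ⟨hp, hp⟩ A

end TrivializationBasis

/-! ### The induced metric on the endomorphism bundle -/

section EndForm

variable {EB HB B : Type*} [NormedAddCommGroup EB] [NormedSpace ℝ EB] [TopologicalSpace HB]
  [TopologicalSpace B] [ChartedSpace HB B]
  {W : Type*} [NormedAddCommGroup W] [NormedSpace ℂ W]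
  {E : B → Type*} [TopologicalSpace (TotalSpace W E)]
  [∀ p, AddCommGroup (E p)] [∀ p, Module ℂ (E p)] [∀ p, TopologicalSpace (E p)]
  [FiberBundle W E]

theorem IsHermitianMetric.isPosHermitian {IR : ModelWithCorners ℝ EB HB} {h : SesqForm E}
    (hh : IsHermitianMetric (W := W) IR h) (p : B) : IsPosHermitian (h p) :=
  ⟨hh.conj_symm p, hh.pos p⟩

theorem contMDiffOn_formMatrix_inv {h : SesqForm E} {ι : Type*} [Fintype ι] [DecidableEq ι]
    [VectorBundle ℂ W E] {IR : ModelWithCorners ℝ EB HB}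
    (hh : IsHermitianMetric (W := W) IR h) (b : Module.Basis ι ℂ W)
    (e : Trivialization W (TotalSpace.proj : TotalSpace W E → B)) [MemTrivializationAtlas e]
    (i j : ι) :
    ContMDiffOn IR 𝓘(ℝ, ℂ) ∞ (fun q => (formMatrix (fun i => e.symm q (b i)) (h q))⁻¹ i j)
      e.baseSet := by
  intro q hq
  have hdet : (formMatrix (fun i => e.symm q (b i)) (h q)).det ≠ 0 := by
    have := (isUnit_det_formMatrix (hh.isPosHermitian q) (fibreBasis b e hq)).ne_zero
    simpa only [funext (fibreBasis_apply b e hq)] using this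
  have h1 : ContMDiffWithinAt IR 𝓘(ℝ, ι → ι → ℂ) ∞
      (fun q => fun i j => h q (e.symm q (b i)) (e.symm q (b j))) e.baseSet q :=
    contMDiffWithinAt_pi_space.2 fun i => contMDiffWithinAt_pi_space.2 fun j =>
      hh.smooth e (b i) (b j) q hq
  exact (contDiffAt_matrix_inv_apply hdet i j).comp_contMDiffWithinAt h1

variable [FiniteDimensional ℂ W] [VectorBundle ℂ W E]
  [∀ p, IsTopologicalAddGroup (E p)] [∀ p, ContinuousSMul ℂ (E p)]

variable {h : SesqForm E} {p : B} {ι : Type*} [Fintype ι] [DecidableEq ι]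

/-- The definition uses the frame of the preferred trivialization at `p` itself; any other basis of
the fibre may replace it, in particular a frame that extends to a neighbourhood. -/
theorem endForm_eq_contraction (hh : IsPosHermitian (h p)) (b : Module.Basis ι ℂ (E p))
    (A B : E p →L[ℂ] E p) :
    endForm W h p A B = contraction (h p) (formComp (h p) A.toLinearMap B.toLinearMap) b := by
  rw [contraction_congr_basis hh b (fibreBasis (Module.finBasis ℂ W) (trivializationAt W E p)
    (mem_baseSet_trivializationAt W E p))]
  simp [endForm, contraction, formMatrix, gram, localFrame]

/-- The hypothesis identifies `C` as `B^* A`, so this is the formula `⟨A, B⟩ = tr(B^* A)`. -/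
theorem endForm_eq_trace (hh : IsPosHermitian (h p)) {A B : E p →L[ℂ] E p} {C : E p →ₗ[ℂ] E p}
    (hC : ∀ x y, h p (A x) (B y) = h p (C x) y) :
    endForm W h p A B = LinearMap.trace ℂ (E p) C := by
  rw [endForm_eq_contraction hh (fibreBasis (Module.finBasis ℂ W) (trivializationAt W E p)
    (mem_baseSet_trivializationAt W E p))]
  exact contraction_eq_trace hh _ hC

/-- In an orthonormal basis `⟨A, A⟩` is the sum of the square norms of the `A b_i`, which vanishes
only if `A` kills a basis. -/
theorem isPosHermitian_endForm (hh : IsPosHermitian (h p)) : IsPosHermitian (endForm W h p) := by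
  let b := fibreBasis (Module.finBasis ℂ W) (trivializationAt W E p)
    (mem_baseSet_trivializationAt W E p)
  refine ⟨fun A B => ?_, fun A hA => ?_⟩
  · rw [endForm_eq_contraction hh b, endForm_eq_contraction hh b]
    exact contraction_conj hh b fun x y => hh.conj_symm _ _
  · rw [endForm_eq_contraction hh b]
    obtain ⟨b', hb'⟩ := exists_contraction_eq_sum hh b
    rw [hb']
    simp only [Complex.re_sum, formComp_apply, ContinuousLinearMap.coe_coe]
    refine Finset.sum_pos' (fun i _ => hh.self_nonneg _) ?_
    by_contra! hne
    apply hA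
    ext x
    have : A.toLinearMap = 0 := b'.ext fun i => by
      simpa using hh.self_eq_zero (le_antisymm (hne i (Finset.mem_univ i)) (hh.self_nonneg _))
    exact LinearMap.congr_fun this x

theorem isHermitianMetric_endForm {IR : ModelWithCorners ℝ EB HB}
    (hh : IsHermitianMetric (W := W) IR h) :
    IsHermitianMetric (W := W →L[ℂ] W) (E := EndBundle E) IR (endForm W h) := by
  refine ⟨fun p => (isPosHermitian_endForm (hh.isPosHermitian p)).conj_symm,
    fun p => (isPosHermitian_endForm (hh.isPosHermitian p)).pos, ?_⟩
  rintro e ⟨he⟩ A B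
  -- A trivialization of the endomorphism bundle may use different trivializations on the source and
  -- on the target. The contraction is taken in the frame of `e₁`, while the values are expressed in
  -- the frame of `e₂`.
  obtain ⟨_, ⟨e₁, e₂, he₁, he₂, rfl⟩, rfl⟩ := he
  change ContMDiffOn IR 𝓘(ℝ, ℂ) ∞ (fun p => endForm W h p
    ((e₁.continuousLinearMap (RingHom.id ℂ) e₂).symm p A)
    ((e₁.continuousLinearMap (RingHom.id ℂ) e₂).symm p B)) (e₁.baseSet ∩ e₂.baseSet)
  let b := Module.finBasis ℂ W
  have key : ∀ p ∈ e₁.baseSet ∩ e₂.baseSet, endForm W h p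
      ((e₁.continuousLinearMap (RingHom.id ℂ) e₂).symm p A)
      ((e₁.continuousLinearMap (RingHom.id ℂ) e₂).symm p B) =
      ∑ i, ∑ j, (formMatrix (fun i => e₁.symm p (b i)) (h p))⁻¹ j i *
        h p (e₂.symm p (A (b i))) (e₂.symm p (B (b j))) := by
    intro p hp
    rw [endForm_eq_contraction (hh.isPosHermitian p) (fibreBasis b e₁ hp.1),
      e₁.continuousLinearMap_symm_eq e₂ hp, e₁.continuousLinearMap_symm_eq e₂ hp, contraction]
    simp only [funext (fibreBasis_apply b e₁ hp.1)]
    refine Finset.sum_congr rfl fun i _ => Finset.sum_congr rfl fun j _ => ?_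
    have h1 : ∀ i, e₁.continuousLinearMapAt ℂ p (e₁.symm p (b i)) = b i := fun i => by
      rw [← e₁.symmL_apply (R := ℂ) hp.1, e₁.continuousLinearMapAt_symmL hp.1]
    simp only [ContinuousLinearMap.coe_comp, Function.comp_apply, formComp_apply,
      ContinuousLinearMap.coe_coe, h1, e₂.symmL_apply (R := ℂ) hp.2]
  refine ContMDiffOn.congr ?_ key
  refine contMDiffOn_finsetSum fun i _ => contMDiffOn_finsetSum fun j _ => ?_
  exact (contDiff_mul (𝕜 := ℝ) (𝔸 := ℂ) (n := ∞)).contMDiff.comp_contMDiffOn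
    (((contMDiffOn_formMatrix_inv hh b e₁ j i).mono inter_subset_left).prodMk_space
      ((hh.smooth e₂ _ _).mono inter_subset_right))

end EndForm

end

noncomputable section

open Filter Topology

/-! ### Calculus of Wirtinger derivatives -/

section WirtingerCalculus

variable {E W W' : Type*} [NormedAddCommGroup E] [NormedSpace ℂ E] [NormedSpace ℝ E]
  [NormedAddCommGroup W] [NormedSpace ℂ W] [NormedAddCommGroup W'] [NormedSpace ℂ W']
  {u z : E}

theorem dHol_congr {f g : E → W} (h : f =ᶠ[𝓝 z] g) : dHol u f z = dHol u g z := by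
  rw [dHol, dHol, h.fderiv_eq]

theorem dBar_congr {f g : E → W} (h : f =ᶠ[𝓝 z] g) : dBar u f z = dBar u g z := by
  rw [dBar, dBar, h.fderiv_eq]

theorem dHol_const (c : W) : dHol u (fun _ : E => c) z = 0 := by
  simp [dHol]

theorem differentiableAt_clm_comp (L : W →L[ℂ] W') {f : E → W} (hf : DifferentiableAt ℝ f z) :
    DifferentiableAt ℝ (fun z => L (f z)) z :=
  (L.restrictScalars ℝ).differentiableAt.comp z hf

theorem dBar_clm_comp (L : W →L[ℂ] W') {f : E → W} (hf : DifferentiableAt ℝ f z) :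
    dBar u (fun z => L (f z)) z = L (dBar u f z) := by
  have : fderiv ℝ (fun z => L (f z)) z = (L.restrictScalars ℝ).comp (fderiv ℝ f z) :=
    ((L.restrictScalars ℝ).hasFDerivAt.comp z hf.hasFDerivAt).fderiv
  simp [dBar, this]

theorem dHol_mul {f g : E → ℂ} (hf : DifferentiableAt ℝ f z) (hg : DifferentiableAt ℝ g z) :
    dHol u (fun z => f z * g z) z = dHol u f z * g z + f z * dHol u g z := by
  simp only [dHol, fderiv_fun_mul hf hg, add_apply,
    smul_apply, smul_eq_mul]
  ring

theorem dHol_sum {ι : Type*} {s : Finset ι} {f : ι → E → W}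
    (hf : ∀ i ∈ s, DifferentiableAt ℝ (f i) z) :
    dHol u (fun z => ∑ i ∈ s, f i z) z = ∑ i ∈ s, dHol u (f i) z := by
  simp [dHol, fderiv_fun_sum hf, ← Finset.smul_sum, Finset.sum_sub_distrib]

theorem differentiableAt_dHol {f : E → W} (hf : ContDiffAt ℝ 2 f z) :
    DifferentiableAt ℝ (dHol u f) z := by
  have h1 : DifferentiableAt ℝ (fderiv ℝ f) z :=
    (hf.fderiv_right (m := 1) (by norm_num [one_add_one_eq_two])).differentiableAt one_ne_zero
  unfold dHol
  exact ((h1.clm_apply (differentiableAt_const u)).sub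
    ((h1.clm_apply (differentiableAt_const _)).const_smul Complex.I)).const_smul (1 / 2 : ℂ)

variable {ι : Type*} [Fintype ι]

/-- The entrywise derivative `∂_u` of a matrix of functions. -/
def dHolMatrix (u : E) (M : E → Matrix ι ι ℂ) (z : E) : Matrix ι ι ℂ :=
  Matrix.of fun i j => dHol u (fun z => M z i j) z

theorem dHolMatrix_mul {M N : E → Matrix ι ι ℂ}
    (hM : ∀ i j, DifferentiableAt ℝ (fun z => M z i j) z)
    (hN : ∀ i j, DifferentiableAt ℝ (fun z => N z i j) z) :
    dHolMatrix u (fun z => M z * N z) z = dHolMatrix u M z * N z + M z * dHolMatrix u N z := by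
  ext i j
  simp only [dHolMatrix, Matrix.of_apply, Matrix.mul_apply, Matrix.add_apply]
  rw [dHol_sum (f := fun k z => M z i k * N z k j) fun k _ => (hM i k).mul (hN k j), ← Finset.sum_add_distrib]
  exact Finset.sum_congr rfl fun k _ => dHol_mul (hM i k) (hN k j)

theorem dHolMatrix_const (M : Matrix ι ι ℂ) : dHolMatrix u (fun _ => M) z = 0 := by
  ext i j
  simp [dHolMatrix, dHol_const]

theorem dHol_trace {M : E → Matrix ι ι ℂ}
    (hM : ∀ i j, DifferentiableAt ℝ (fun z => M z i j) z) :
    dHol u (fun z => (M z).trace) z = (dHolMatrix u M z).trace := by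
  simp only [Matrix.trace, Matrix.diag]
  rw [dHol_sum fun i _ => hM i i]
  rfl

variable [DecidableEq ι]

/-- Differentiate `G⁻¹ G = 1`. -/
theorem dHolMatrix_inv {G : E → Matrix ι ι ℂ}
    (hG : ∀ i j, DifferentiableAt ℝ (fun z => G z i j) z)
    (hG' : ∀ i j, DifferentiableAt ℝ (fun z => (G z)⁻¹ i j) z)
    (hdet : ∀ᶠ z in 𝓝 z, IsUnit (G z).det) :
    dHolMatrix u (fun z => (G z)⁻¹) z = -((G z)⁻¹ * dHolMatrix u G z * (G z)⁻¹) := by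
  have h1 : dHolMatrix u (fun z => (G z)⁻¹ * G z) z = 0 := by
    rw [← dHolMatrix_const (u := u) (z := z) (1 : Matrix ι ι ℂ)]
    ext i j
    refine dHol_congr ?_
    filter_upwards [hdet] with y hy
    simp only [Matrix.nonsing_inv_mul _ hy]
  rw [dHolMatrix_mul hG' hG] at h1
  have h2 := congrArg (· * (G z)⁻¹) (eq_neg_of_add_eq_zero_left h1)
  simpa only [Matrix.mul_nonsing_inv_cancel_right _ _ hdet.self_of_nhds, Matrix.neg_mul] using h2

end WirtingerCalculus

section AdjointAction

variable (W : Type*) [NormedAddCommGroup W] [NormedSpace ℂ W]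

/-- The adjoint action `R ↦ (A ↦ R A - A R)` of endomorphisms on endomorphisms. -/
def adAction : (W →L[ℂ] W) →L[ℂ] ((W →L[ℂ] W) →L[ℂ] (W →L[ℂ] W)) :=
  ContinuousLinearMap.compL ℂ W W W - (ContinuousLinearMap.compL ℂ W W W).flip

@[simp] theorem adAction_apply (R A : W →L[ℂ] W) :
    adAction W R A = R.comp A - A.comp R := rfl

end AdjointAction

/-! ### The curvature of the endomorphism bundle is the adjoint action -/

section Curvature

variable {EB HB B : Type*} [NormedAddCommGroup EB] [NormedSpace ℂ EB] [NormedSpace ℝ EB]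
  [TopologicalSpace HB] [TopologicalSpace B] [ChartedSpace HB B]
  {W : Type*} [NormedAddCommGroup W] [NormedSpace ℂ W]
  {E : B → Type*} [TopologicalSpace (TotalSpace W E)]
  [∀ p, AddCommGroup (E p)] [∀ p, Module ℂ (E p)] [∀ p, TopologicalSpace (E p)]
  [FiberBundle W E]

variable (W) in
/-- The form `h` in the preferred trivialization and chart around `p`. -/
def localForm (I : ModelWithCorners ℂ EB HB) (h : SesqForm E) (p : B) (z : EB) (a c : W) : ℂ :=
  h ((extChartAt I p).symm z) ((trivializationAt W E p).symm ((extChartAt I p).symm z) a)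
    ((trivializationAt W E p).symm ((extChartAt I p).symm z) c)

variable [FiniteDimensional ℂ W] {I : ModelWithCorners ℂ EB HB} {h : SesqForm E} {p : B}

theorem localMatrix_apply (z : EB) (i j : Fin (Module.finrank ℂ W)) :
    localMatrix I h p z i j =
      localForm W I h p z (Module.finBasis ℂ W i) (Module.finBasis ℂ W j) := rfl

variable [VectorBundle ℂ W E]

variable (W) in
theorem eventually_mem_baseSet (I : ModelWithCorners ℂ EB HB) (p : B) :
    ∀ᶠ z in 𝓝 (extChartAt I p p), (extChartAt I p).symm z ∈ (trivializationAt W E p).baseSet := by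
  refine (continuousAt_extChartAt_symm p).eventually_mem ?_
  rw [extChartAt_to_inv]
  exact (trivializationAt W E p).open_baseSet.mem_nhds (mem_baseSet_trivializationAt W E p)

theorem localMatrix_eq_formMatrix (z : EB)
    (hz : (extChartAt I p).symm z ∈ (trivializationAt W E p).baseSet) :
    localMatrix I h p z = formMatrix (fibreBasis (Module.finBasis ℂ W) (trivializationAt W E p) hz)
      (h ((extChartAt I p).symm z)) := by
  ext i j
  simp only [localMatrix_apply, localForm, formMatrix, Matrix.of_apply, fibreBasis_apply]

theorem isUnit_det_localMatrix (hh : ∀ q, IsPosHermitian (h q)) (z : EB)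
    (hz : (extChartAt I p).symm z ∈ (trivializationAt W E p).baseSet) :
    IsUnit (localMatrix (W := W) I h p z).det := by
  rw [localMatrix_eq_formMatrix z hz]
  exact isUnit_det_formMatrix (hh _) _

theorem localForm_apply_left {z : EB}
    (hz : (extChartAt I p).symm z ∈ (trivializationAt W E p).baseSet) (a : W →ₗ[ℂ] W)
    (i j : Fin (Module.finrank ℂ W)) :
    localForm W I h p z (a (Module.finBasis ℂ W i)) (Module.finBasis ℂ W j) =
      ((LinearMap.toMatrix (Module.finBasis ℂ W) (Module.finBasis ℂ W) a).transpose *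
        localMatrix I h p z : Matrix _ _ ℂ) i j := by
  simp only [localForm, Matrix.mul_apply, Matrix.transpose_apply, localMatrix_apply,
    LinearMap.toMatrix_apply, ← Trivialization.symmL_apply (R := ℂ) _ hz]
  conv_lhs => rw [← (Module.finBasis ℂ W).sum_repr (a _)]
  simp only [map_sum, map_smul, LinearMap.sum_apply, LinearMap.smul_apply, smul_eq_mul]

/-- If the operators `Θ z` represent `∂_u h`, then `- ∂̄_w Θ` represents the curvature. -/
theorem chernCurvature_eq (hh : ∀ q, IsPosHermitian (h q)) {u w : EB} {Θ : EB → (W →L[ℂ] W)}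
    (hΘ : ∀ᶠ z in 𝓝 (extChartAt I p p), ∀ i j,
      localForm W I h p z (Θ z (Module.finBasis ℂ W i)) (Module.finBasis ℂ W j) =
        dHol u (fun z => localForm W I h p z (Module.finBasis ℂ W i) (Module.finBasis ℂ W j)) z)
    (hd : DifferentiableAt ℝ Θ (extChartAt I p p)) :
    chernCurvature W I h p u w = ((trivializationAt W E p).symmL ℂ p).comp
      ((-dBar w Θ (extChartAt I p p)).comp ((trivializationAt W E p).continuousLinearMapAt ℂ p)) := by
  let b := Module.finBasis ℂ W
  have h1 : ∀ᶠ z in 𝓝 (extChartAt I p p), connectionMatrix I h p u z =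
      (LinearMap.toMatrix b b (Θ z).toLinearMap).transpose := by
    filter_upwards [hΘ, eventually_mem_baseSet W (E := E) I p] with z hz hzb
    have : (Matrix.of fun i j => dHol u (fun z' => localMatrix I h p z' i j) z) =
        (LinearMap.toMatrix b b (Θ z).toLinearMap).transpose * localMatrix I h p z := by
      ext i j
      rw [← localForm_apply_left hzb]
      exact (hz i j).symm
    rw [connectionMatrix, this,
      Matrix.mul_nonsing_inv_cancel_right _ _ (isUnit_det_localMatrix hh z hzb)]
  have h2 : curvatureMatrix I h p u w =
      (LinearMap.toMatrix b b (-dBar w Θ (extChartAt I p p)).toLinearMap).transpose := by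
    ext i j
    -- Reading off a matrix entry is a complex linear functional, so it commutes with `∂̄`.
    let L : (W →L[ℂ] W) →L[ℂ] ℂ :=
      (LinearMap.toContinuousLinearMap (b.coord j)).comp (ContinuousLinearMap.apply ℂ W (b i))
    have hL : ∀ A : W →L[ℂ] W, L A =
        (LinearMap.toMatrix b b A.toLinearMap).transpose i j := fun A => by
      simp [L, LinearMap.toMatrix_apply]
    rw [← hL, map_neg, ← dBar_clm_comp L hd, curvatureMatrix, Matrix.of_apply]
    congr 1
    refine dBar_congr ?_
    filter_upwards [h1] with z hz
    rw [hz, hL]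
  unfold chernCurvature
  rw [h2, Matrix.transpose_transpose, Matrix.toLin_toMatrix]
  congr 2

/-- The matrix of functions is smooth at the centre of the chart. -/
theorem differentiableAt_localMatrix_inv (hh : ∀ q, IsPosHermitian (h q)) {z : EB}
    (hz : (extChartAt I p).symm z ∈ (trivializationAt W E p).baseSet)
    (hs : ∀ i j, DifferentiableAt ℝ (fun z => localMatrix (W := W) I h p z i j) z)
    (i j : Fin (Module.finrank ℂ W)) :
    DifferentiableAt ℝ (fun z => (localMatrix (W := W) I h p z)⁻¹ i j) z :=
  ((contDiffAt_matrix_inv_apply (k := 1) (isUnit_det_localMatrix hh z hz).ne_zero i j).differentiableAt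
    one_ne_zero).comp z (f := fun z i j => localMatrix I h p z i j) (differentiableAt_pi.2 fun i => differentiableAt_pi.2 fun j => hs i j)

variable (W) in
/-- The operator-valued connection form in the preferred trivialization. -/
def connectionOperator (I : ModelWithCorners ℂ EB HB) (h : SesqForm E) (p : B) (u z : EB) :
    W →L[ℂ] W :=
  LinearMap.toContinuousLinearMap (Matrix.toLin (Module.finBasis ℂ W) (Module.finBasis ℂ W)
    (connectionMatrix I h p u z).transpose)

theorem differentiableAt_connectionOperator (hh : ∀ q, IsPosHermitian (h q)) {u : EB}
    (hs : ∀ a c, ContDiffAt ℝ 2 (fun z => localForm W I h p z a c) (extChartAt I p p)) :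
    DifferentiableAt ℝ (connectionOperator W I h p u) (extChartAt I p p) := by
  have hdiff : ∀ i j, DifferentiableAt ℝ (fun z => connectionMatrix (W := W) I h p u z i j)
      (extChartAt I p p) := fun i j => by
    simp only [connectionMatrix, Matrix.mul_apply, Matrix.of_apply]
    refine DifferentiableAt.fun_sum fun k _ => DifferentiableAt.mul ?_ ?_
    · exact differentiableAt_dHol (hs _ _)
    · exact differentiableAt_localMatrix_inv hh (eventually_mem_baseSet W I p).self_of_nhds
        (fun i j => (hs _ _).differentiableAt two_ne_zero) k j
  let L : (Fin (Module.finrank ℂ W) → Fin (Module.finrank ℂ W) → ℂ) →ₗ[ℂ] (W →L[ℂ] W) :=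
    { toFun := fun M => LinearMap.toContinuousLinearMap
        (Matrix.toLin (Module.finBasis ℂ W) (Module.finBasis ℂ W) (Matrix.of M).transpose)
      map_add' := fun M N => by
        rw [← map_add, ← map_add]; rfl
      map_smul' := fun c M => by
        rw [RingHom.id_apply, ← map_smul, ← map_smul]; rfl }
  exact (((LinearMap.toContinuousLinearMap L).restrictScalars ℝ).differentiableAt).comp _
    (differentiableAt_pi.2 fun i => differentiableAt_pi.2 fun j => hdiff i j)

theorem toMatrix_connectionOperator (u z : EB) :
    LinearMap.toMatrix (Module.finBasis ℂ W) (Module.finBasis ℂ W)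
      (connectionOperator W I h p u z).toLinearMap = (connectionMatrix I h p u z).transpose :=
  LinearMap.toMatrix_toLin _ _ _

theorem chernCurvature_eq_connectionOperator (hh : ∀ q, IsPosHermitian (h q)) {u w : EB}
    (hs : ∀ a c, ContDiffAt ℝ 2 (fun z => localForm W I h p z a c) (extChartAt I p p)) :
    chernCurvature W I h p u w = ((trivializationAt W E p).symmL ℂ p).comp
      ((-dBar w (connectionOperator W I h p u) (extChartAt I p p)).comp
        ((trivializationAt W E p).continuousLinearMapAt ℂ p)) := by
  refine chernCurvature_eq hh ?_ (differentiableAt_connectionOperator hh hs)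
  filter_upwards [eventually_mem_baseSet W (E := E) I p] with z hz i j
  have := localForm_apply_left (h := h) hz (connectionOperator W I h p u z).toLinearMap i j
  rw [toMatrix_connectionOperator, Matrix.transpose_transpose, connectionMatrix,
    Matrix.nonsing_inv_mul_cancel_right _ _ (isUnit_det_localMatrix hh z hz)] at this
  exact this

variable [∀ p, IsTopologicalAddGroup (E p)] [∀ p, ContinuousSMul ℂ (E p)]

/-- In the frame, `⟨A, C⟩ = tr(H⁻¹ Aᵀ H C̄)`. For constant `A` and `C` only the Gram matrix `H`
depends on the point, so the product rule differentiates the induced metric. -/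
theorem localForm_endForm (hh : ∀ q, IsPosHermitian (h q)) {z : EB}
    (hz : (extChartAt I p).symm z ∈ (trivializationAt W E p).baseSet) (A C : W →L[ℂ] W) :
    localForm (W →L[ℂ] W) (E := EndBundle E) I (endForm W h) p z A C =
      ((localMatrix I h p z)⁻¹ *
        (LinearMap.toMatrix (Module.finBasis ℂ W) (Module.finBasis ℂ W) A.toLinearMap).transpose *
        localMatrix I h p z *
        (LinearMap.toMatrix (Module.finBasis ℂ W) (Module.finBasis ℂ W)
          C.toLinearMap).map conj).trace := by
  rw [localForm, endBundle_symm_eq p hz, endBundle_symm_eq p hz,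
    endForm_eq_contraction (hh _) (fibreBasis (Module.finBasis ℂ W) (trivializationAt W E p) hz),
    contraction_eq_trace_mul, localMatrix_eq_formMatrix z hz, Matrix.mul_assoc, Matrix.mul_assoc]
  congr 2
  ext i j
  have h1 : ∀ i, (trivializationAt W E p).continuousLinearMapAt ℂ ((extChartAt I p).symm z)
      ((trivializationAt W E p).symm ((extChartAt I p).symm z) (Module.finBasis ℂ W i)) =
      Module.finBasis ℂ W i := fun i => by
    rw [← Trivialization.symmL_apply (R := ℂ) _ hz, Trivialization.continuousLinearMapAt_symmL _ hz]
  simp only [formMatrix, Matrix.of_apply, fibreBasis_apply, formComp_apply,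
    ContinuousLinearMap.coe_coe, ContinuousLinearMap.coe_comp, Function.comp_apply, h1,
    Matrix.mul_apply, Matrix.transpose_apply, Matrix.map_apply, LinearMap.toMatrix_apply]
  conv_lhs => rw [← (Module.finBasis ℂ W).sum_repr (A _), ← (Module.finBasis ℂ W).sum_repr (C _)]
  simp only [map_sum, map_smul, LinearMap.sum_apply, LinearMap.smul_apply, map_smulₛₗ,
    smul_eq_mul, Finset.mul_sum, ← Trivialization.symmL_apply (R := ℂ) _ hz]
  rw [Finset.sum_comm]
  refine Finset.sum_congr rfl fun k _ => Finset.sum_congr rfl fun l _ => ?_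
  ring

-- Differentiating `tr(H⁻¹ Aᵀ H C̄)` gives `tr(H⁻¹ (Aᵀ θ - θ Aᵀ) H C̄)` with `θ = ∂H · H⁻¹`: the
-- connection form of the induced metric is `ad` of the original one. As `ad` is a constant complex
-- linear map, it commutes with `∂̄`, and the curvature is `ad` of the curvature.
set_option synthInstance.maxHeartbeats 200000 in
theorem chernCurvature_endForm (hh : ∀ q, IsPosHermitian (h q)) {u w : EB}
    (hs : ∀ a c, ContDiffAt ℝ 2 (fun z => localForm W I h p z a c) (extChartAt I p p))
    (A : E p →L[ℂ] E p) :
    chernCurvature (W →L[ℂ] W) (E := EndBundle E) I (endForm W h) p u w A =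
      (chernCurvature W I h p u w).comp A - A.comp (chernCurvature W I h p u w) := by
  have hd := differentiableAt_connectionOperator (u := u) hh hs
  have hd' : DifferentiableAt ℝ (fun z => adAction W (connectionOperator W I h p u z))
      (extChartAt I p p) :=
    differentiableAt_clm_comp (W := W →L[ℂ] W) (W' := (W →L[ℂ] W) →L[ℂ] (W →L[ℂ] W)) (adAction W) hd
  have hp := mem_baseSet_trivializationAt W E p
  rw [chernCurvature_eq_connectionOperator hh hs,
    chernCurvature_eq (fun q => isPosHermitian_endForm (hh q)) (w := w) ?_ hd',
    dBar_clm_comp (W := W →L[ℂ] W) (W' := (W →L[ℂ] W) →L[ℂ] (W →L[ℂ] W)) (adAction W) hd]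
  · generalize dBar w (connectionOperator W I h p u) (extChartAt I p p) = D
    rw [ContinuousLinearMap.comp_apply, ContinuousLinearMap.comp_apply,
      endBundle_continuousLinearMapAt_eq p hp, endBundle_symmL_eq p hp]
    ext x
    simp only [neg_apply, adAction_apply, sub_apply, ContinuousLinearMap.comp_apply, map_neg,
      map_sub, Trivialization.symmL_continuousLinearMapAt _ hp]
    abel
  · have hsm : ∀ᶠ z in 𝓝 (extChartAt I p p), ∀ i j,
        DifferentiableAt ℝ (fun z => localMatrix (W := W) I h p z i j) z := by
      simp only [Filter.eventually_all]
      intro i j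
      exact ((hs _ _).eventually (by simp)).mono fun z hz => hz.differentiableAt two_ne_zero
    have hmem := eventually_mem_baseSet W (E := E) I p
    filter_upwards [hsm, hmem.eventually_nhds] with z hz hzmem i j
    -- The identity holds for all constant `A` and `C`; the chosen basis of the endomorphisms of `W`
    -- plays no role.
    generalize (Module.finBasis ℂ (W →L[ℂ] W)) i = A
    generalize (Module.finBasis ℂ (W →L[ℂ] W)) j = C
    have hzb := hzmem.self_of_nhds
    have hu := isUnit_det_localMatrix (W := W) hh z hzb
    have hinv := fun i j => differentiableAt_localMatrix_inv hh hzb hz i j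
    rw [localForm_endForm hh hzb]
    rw [dHol_congr (hzmem.mono fun y hy => localForm_endForm hh hy A C)]
    have hmat : LinearMap.toMatrix (Module.finBasis ℂ W) (Module.finBasis ℂ W)
        (adAction W (connectionOperator W I h p u z) A).toLinearMap =
        (connectionMatrix I h p u z).transpose *
            LinearMap.toMatrix (Module.finBasis ℂ W) (Module.finBasis ℂ W) A.toLinearMap -
          LinearMap.toMatrix (Module.finBasis ℂ W) (Module.finBasis ℂ W) A.toLinearMap * (connectionMatrix I h p u z).transpose := by
      rw [← toMatrix_connectionOperator, ← LinearMap.toMatrix_comp, ← LinearMap.toMatrix_comp,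
        ← map_sub]
      rfl
    have hθ : connectionMatrix I h p u z =
        dHolMatrix u (localMatrix (W := W) I h p) z *
          (localMatrix I h p z)⁻¹ := rfl
    have hconst : ∀ (M : Matrix (Fin (Module.finrank ℂ W)) (Fin (Module.finrank ℂ W)) ℂ) (i j),
        DifferentiableAt ℝ (fun _ : EB => M i j) z := fun M i j => differentiableAt_const _
    have hm : ∀ {M N : EB → Matrix (Fin (Module.finrank ℂ W)) (Fin (Module.finrank ℂ W)) ℂ},
        (∀ i j, DifferentiableAt ℝ (fun z => M z i j) z) →
        (∀ i j, DifferentiableAt ℝ (fun z => N z i j) z) →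
        ∀ i j, DifferentiableAt ℝ (fun z => (M z * N z) i j) z := fun hM hN i j => by
      simp only [Matrix.mul_apply]
      exact DifferentiableAt.fun_sum fun k _ => (hM i k).mul (hN k j)
    rw [hmat, hθ, dHol_trace (hm (hm (hm hinv (hconst _)) hz) (hconst _)),
      dHolMatrix_mul (hm (hm hinv (hconst _)) hz) (hconst _),
      dHolMatrix_mul (hm hinv (hconst _)) hz, dHolMatrix_mul hinv (hconst _),
      dHolMatrix_inv hz hinv (hzmem.mono fun y hy => isUnit_det_localMatrix hh y hy)]
    simp only [dHolMatrix_const, mul_zero, add_zero, Matrix.transpose_sub, Matrix.transpose_mul,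
      Matrix.transpose_transpose]
    congr 1
    simp only [Matrix.mul_sub, Matrix.sub_mul, Matrix.add_mul, Matrix.neg_mul, Matrix.mul_assoc,
      Matrix.nonsing_inv_mul_cancel_left _ _ hu]
    abel

end Curvature

end

noncomputable section

open Filter Topology

/-! ### The dual of the adjoint action for the trace pairing -/

section TraceDual

variable {T : Type*} [AddCommGroup T] [Module ℂ T] [TopologicalSpace T] [IsTopologicalAddGroup T]
  [ContinuousSMul ℂ T]

/-- The adjoint action `R ↦ (A ↦ R A - A R)` as a bilinear map. -/
def adLinear : (T →L[ℂ] T) →ₗ[ℂ] (T →L[ℂ] T) →ₗ[ℂ] (T →L[ℂ] T) :=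
  LinearMap.mk₂ ℂ (fun R A => R.comp A - A.comp R)
    (fun R R' A => by simp only [ContinuousLinearMap.add_comp, ContinuousLinearMap.comp_add]; abel)
    (fun c R A => by simp [smul_sub])
    (fun R A A' => by simp only [ContinuousLinearMap.add_comp, ContinuousLinearMap.comp_add]; abel)
    (fun c R A => by simp [smul_sub])

@[simp] theorem adLinear_apply (R A : T →L[ℂ] T) : adLinear R A = R.comp A - A.comp R := rfl

theorem adLinear_id : adLinear (ContinuousLinearMap.id ℂ T) = 0 := by
  ext A x
  simp

variable [T2Space T] [FiniteDimensional ℂ T]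

theorem eq_of_trace_comp_eq {K K' : T →L[ℂ] T}
    (hK : ∀ R : T →L[ℂ] T, LinearMap.trace ℂ T (R.comp K).toLinearMap =
      LinearMap.trace ℂ T (R.comp K').toLinearMap) : K = K' := by
  let b := Module.finBasis ℂ T
  have : LinearMap.toMatrix b b K.toLinearMap = LinearMap.toMatrix b b K'.toLinearMap := by
    refine Matrix.ext_iff_trace_mul_left.2 fun M => ?_
    have := hK (LinearMap.toContinuousLinearMap (Matrix.toLin b b M))
    simpa [LinearMap.trace_eq_matrix_trace ℂ b, LinearMap.toMatrix_comp b b b] using this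
  ext x
  exact LinearMap.congr_fun ((LinearMap.toMatrix b b).injective this) x

/-- The endomorphism that represents a linear functional on endomorphisms by the trace pairing. -/
def traceDual : ((T →L[ℂ] T) →ₗ[ℂ] ℂ) →ₗ[ℂ] (T →L[ℂ] T) :=
  let b := Module.finBasis ℂ T
  -- Since `tr(E_{ij} K) = K_{ji}`, the entry at `(j, i)` has to be the value of `φ` at the matrix
  -- unit `E_{ij}`.
  { toFun := fun φ => LinearMap.toContinuousLinearMap (Matrix.toLin b b (Matrix.of fun j i =>
      φ (LinearMap.toContinuousLinearMap (Matrix.toLin b b (Matrix.single i j 1)))))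
    map_add' := fun φ ψ => by rw [← map_add, ← map_add]; rfl
    map_smul' := fun c φ => by rw [RingHom.id_apply, ← map_smul, ← map_smul]; rfl }

theorem trace_comp_traceDual (φ : (T →L[ℂ] T) →ₗ[ℂ] ℂ) (R : T →L[ℂ] T) :
    LinearMap.trace ℂ T (R.comp (traceDual φ)).toLinearMap = φ R := by
  let b := Module.finBasis ℂ T
  obtain ⟨M, rfl⟩ : ∃ M, R = LinearMap.toContinuousLinearMap (Matrix.toLin b b M) :=
    ⟨LinearMap.toMatrix b b R.toLinearMap, by rw [Matrix.toLin_toMatrix]; rfl⟩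
  have h1 : LinearMap.trace ℂ T ((LinearMap.toContinuousLinearMap (Matrix.toLin b b M)).comp
      (traceDual φ)).toLinearMap = (M * Matrix.of fun j i => φ (LinearMap.toContinuousLinearMap
        (Matrix.toLin b b (Matrix.single i j 1)))).trace := by
    rw [LinearMap.trace_eq_matrix_trace ℂ b, ContinuousLinearMap.toLinearMap_comp,
      LinearMap.toMatrix_comp b b b]
    simp [traceDual, b]
  rw [h1]
  conv_rhs => rw [Matrix.matrix_eq_sum_single M]
  simp only [map_sum, Matrix.trace, Matrix.diag, Matrix.mul_apply, Matrix.of_apply]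
  refine Finset.sum_congr rfl fun i _ => Finset.sum_congr rfl fun j _ => ?_
  rw [← smul_eq_mul, ← map_smul, ← map_smul, ← map_smul, Matrix.smul_single, smul_eq_mul, mul_one]

/-- The functional `R ↦ tr (ad R ∘ η)`. -/
def adTrace : ((T →L[ℂ] T) →L[ℂ] (T →L[ℂ] T)) →ₗ[ℂ] ((T →L[ℂ] T) →ₗ[ℂ] ℂ) where
  toFun η := (LinearMap.trace ℂ (T →L[ℂ] T)).comp
    ((LinearMap.lcomp ℂ (T →L[ℂ] T) η.toLinearMap).comp adLinear)
  map_add' η η' := by ext R; simp [LinearMap.lcomp_apply', LinearMap.comp_add]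
  map_smul' c η := by ext R; simp [LinearMap.lcomp_apply', LinearMap.comp_smul]

/-- The contraction `End (End T) → End T` that is dual to the adjoint action with respect to the
trace pairings. -/
def endContraction : ((T →L[ℂ] T) →L[ℂ] (T →L[ℂ] T)) →ₗ[ℂ] (T →L[ℂ] T) :=
  traceDual.comp adTrace

theorem trace_comp_endContraction (η : (T →L[ℂ] T) →L[ℂ] (T →L[ℂ] T)) (R : T →L[ℂ] T) :
    LinearMap.trace ℂ T (R.comp (endContraction η)).toLinearMap =
      LinearMap.trace ℂ (T →L[ℂ] T) ((adLinear R).comp η.toLinearMap) :=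
  trace_comp_traceDual (adTrace η) R

/-- If the contraction of `η` is a multiple of the identity, it is zero. -/
theorem trace_adLinear_comp_eq_zero {η : (T →L[ℂ] T) →L[ℂ] (T →L[ℂ] T)} {c : ℂ}
    (hc : endContraction η = c • ContinuousLinearMap.id ℂ T) (R : T →L[ℂ] T) :
    LinearMap.trace ℂ (T →L[ℂ] T) ((adLinear R).comp η.toLinearMap) = 0 := by
  have key : ∀ R : T →L[ℂ] T, LinearMap.trace ℂ (T →L[ℂ] T) ((adLinear R).comp η.toLinearMap) =
      c * LinearMap.trace ℂ T R.toLinearMap := fun R => by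
    rw [← trace_comp_endContraction, hc]
    simp
  -- At the identity the left side vanishes because `ad id = 0`, and the right side is `c` times the
  -- rank. Either `c = 0`, or the space is zero and all traces vanish.
  have h1 := key (ContinuousLinearMap.id ℂ T)
  rw [adLinear_id, LinearMap.zero_comp, map_zero, ContinuousLinearMap.coe_id,
    LinearMap.trace_id] at h1
  rcases mul_eq_zero.1 h1.symm with h | h
  · rw [key, h, zero_mul]
  · have : Subsingleton T := Module.finrank_zero_iff.1 (Nat.cast_eq_zero.1 h)
    rw [key, show R.toLinearMap = 0 from Subsingleton.elim _ _, map_zero, mul_zero]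

/-- Left and right multiplication by a matrix have the same trace. In the basis of matrix units the
diagonal entries at `(i, j)` are `R_{ii}` and `R_{jj}`, and both double sums agree. -/
theorem trace_adLinear (R : T →L[ℂ] T) : LinearMap.trace ℂ (T →L[ℂ] T) (adLinear R) = 0 := by
  let b := Module.finBasis ℂ T
  let φ : (T →L[ℂ] T) ≃ₗ[ℂ] Matrix _ _ ℂ :=
    LinearMap.toContinuousLinearMap.symm.trans (LinearMap.toMatrix b b)
  have hφ : ∀ A B, φ (A.comp B) = φ A * φ B := fun A B => LinearMap.toMatrix_comp b b b _ _
  have h1 : φ.conj (adLinear R) = LinearMap.mulLeft ℂ (φ R) - LinearMap.mulRight ℂ (φ R) := by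
    ext1 A
    simp [LinearEquiv.conj_apply, hφ]
  rw [← LinearMap.trace_conj' (adLinear R) φ, h1, map_sub,
    LinearMap.trace_eq_matrix_trace ℂ (Matrix.stdBasis ℂ _ _),
    LinearMap.trace_eq_matrix_trace ℂ (Matrix.stdBasis ℂ _ _)]
  have h2 : ∀ (M : Matrix (Fin (Module.finrank ℂ T)) (Fin (Module.finrank ℂ T)) ℂ) i j,
      (Matrix.stdBasis ℂ _ _).repr M (i, j) = M i j := fun M i j => rfl
  simp only [Matrix.trace, Matrix.diag, LinearMap.toMatrix_apply, Fintype.sum_prod_type, h2,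
    Matrix.stdBasis_eq_single, LinearMap.mulLeft_apply, LinearMap.mulRight_apply]
  rw [sub_eq_zero, Finset.sum_comm]
  simp

variable {T' : Type*} [AddCommGroup T'] [Module ℂ T'] [TopologicalSpace T']
  [IsTopologicalAddGroup T'] [ContinuousSMul ℂ T'] [T2Space T'] [FiniteDimensional ℂ T']

/-- The construction chooses a basis, but the trace pairing characterizes its result, and
conjugation preserves traces. Hence the contraction is compatible with trivializations. -/
theorem endContraction_conj (e : T ≃L[ℂ] T') {η : (T →L[ℂ] T) →L[ℂ] (T →L[ℂ] T)}
    {η' : (T' →L[ℂ] T') →L[ℂ] (T' →L[ℂ] T')}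
    (hη : ∀ A : T' →L[ℂ] T', η' A = e.toContinuousLinearMap.comp
      ((η (e.symm.toContinuousLinearMap.comp (A.comp e.toContinuousLinearMap))).comp
        e.symm.toContinuousLinearMap)) :
    endContraction η' = e.toContinuousLinearMap.comp
      ((endContraction η).comp e.symm.toContinuousLinearMap) := by
  let φ : (T →L[ℂ] T) ≃ₗ[ℂ] (T' →L[ℂ] T') :=
    { toFun := fun A => e.toContinuousLinearMap.comp (A.comp e.symm.toContinuousLinearMap)
      invFun := fun A => e.symm.toContinuousLinearMap.comp (A.comp e.toContinuousLinearMap)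
      map_add' := fun A B => by ext; simp
      map_smul' := fun c A => by ext; simp
      left_inv := fun A => by ext; simp
      right_inv := fun A => by ext; simp }
  refine eq_of_trace_comp_eq fun R => ?_
  rw [trace_comp_endContraction]
  have h1 : (adLinear R).comp η'.toLinearMap =
      φ.conj ((adLinear (φ.symm R)).comp η.toLinearMap) := by
    ext A x
    simp [LinearEquiv.conj_apply, φ, hη]
  have h2 : (R.comp (e.toContinuousLinearMap.comp
      ((endContraction η).comp e.symm.toContinuousLinearMap))).toLinearMap =
      e.toLinearEquiv.conj ((φ.symm R).comp (endContraction η)).toLinearMap := by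
    ext x
    simp [LinearEquiv.conj_apply, φ]
  rw [h1, h2, LinearMap.trace_conj', LinearMap.trace_conj', trace_comp_endContraction]

end TraceDual

/-! ### Pointwise orthogonality to inner derivations -/

section Orthogonality

variable {B : Type*} [TopologicalSpace B]
  {W : Type*} [NormedAddCommGroup W] [NormedSpace ℂ W] [FiniteDimensional ℂ W]
  {E : B → Type*} [TopologicalSpace (TotalSpace W E)]
  [∀ p, AddCommGroup (E p)] [∀ p, Module ℂ (E p)] [∀ p, TopologicalSpace (E p)]
  [FiberBundle W E] [VectorBundle ℂ W E]
  [∀ p, IsTopologicalAddGroup (E p)] [∀ p, ContinuousSMul ℂ (E p)]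
  {h : SesqForm E} {p : B}

/-- With `C = R^*` this is `(ad R)^* = ad(R^*)`. Left multiplication by `R` is moved across `h`
directly; right multiplication needs the cyclicity of the trace. -/
theorem endForm_adLinear (hh : IsPosHermitian (h p)) {R C : E p →L[ℂ] E p}
    (hC : ∀ x y, h p x (R y) = h p (C x) y) (A D : E p →L[ℂ] E p) :
    endForm W h p A (adLinear R D) = endForm W h p (adLinear C A) D := by
  let b := fibreBasis (Module.finBasis ℂ W) (trivializationAt W E p)
    (mem_baseSet_trivializationAt W E p)
  -- `U` is `D^* A`.
  obtain ⟨U, hU⟩ := exists_form_eq_comp hh b (formComp (h p) A.toLinearMap D.toLinearMap)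
  simp only [formComp_apply, ContinuousLinearMap.coe_coe] at hU
  have h1 : endForm W h p A (R.comp D) = endForm W h p (C.comp A) D := by
    rw [endForm_eq_contraction hh b, endForm_eq_contraction hh b]
    congr 1
    ext x y
    simp [hC]
  have h2 : endForm W h p A (D.comp R) = LinearMap.trace ℂ _ (C.toLinearMap ∘ₗ U) :=
    endForm_eq_trace hh fun x y => by simp [hU, hC]
  have h3 : endForm W h p (A.comp C) D = LinearMap.trace ℂ _ (U ∘ₗ C.toLinearMap) :=
    endForm_eq_trace hh fun x y => by simp [hU]
  have hF : FiniteDimensional ℂ (E p) := b.finiteDimensional_of_finite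
  rw [adLinear_apply, adLinear_apply, map_sub, map_sub, LinearMap.sub_apply, h1, h2, h3,
    LinearMap.trace_comp_comm']

/-- Up to conjugation the product is `⟨η, ad R⟩ = tr((ad R)^* η) = tr(ad(R^*) η)`, which vanishes by
assumption. -/
theorem endForm_endForm_eq_zero (hh : IsPosHermitian (h p)) {R : E p →L[ℂ] E p}
    {P η : (E p →L[ℂ] E p) →L[ℂ] (E p →L[ℂ] E p)} (hP : ∀ A, P A = adLinear R A)
    (hη : ∀ C : E p →L[ℂ] E p,
      LinearMap.trace ℂ (E p →L[ℂ] E p) ((adLinear C).comp η.toLinearMap) = 0) :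
    endForm (W →L[ℂ] W) (E := EndBundle E) (endForm W h) p P η = 0 := by
  have hT : T2Space (E p) :=
    t2Space_fibre (trivializationAt W E p) (mem_baseSet_trivializationAt W E p)
  have hF : FiniteDimensional ℂ (E p) := finiteDimensional_fibre (Module.finBasis ℂ W) p
  have hH := isPosHermitian_endForm (W := W) hh
  obtain ⟨C, hC⟩ := hh.exists_adjoint R.toLinearMap
  rw [(isPosHermitian_endForm (W := W →L[ℂ] W) (E := EndBundle E) hH).conj_symm,
    endForm_eq_trace (W := W →L[ℂ] W) (E := EndBundle E) hH
      (C := (adLinear (LinearMap.toContinuousLinearMap C)).comp η.toLinearMap), hη, map_zero]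
  intro A D
  rw [hP, endForm_adLinear hh (C := LinearMap.toContinuousLinearMap C) hC]
  rfl

end Orthogonality

end

noncomputable section

open Filter Topology MeasureTheory

/-! ### Integration over `X` -/

section Base

variable {n : ℕ} {X : Type*} [TopologicalSpace X] [ChartedSpace (Fin n → ℂ) X]
  [IsManifold 𝓘(ℂ, Fin n → ℂ) ω X] {g : TangentForm n X}

theorem coordMetric_eq_formMatrix (g : TangentForm n X) (x : X) {y : X}
    (hy : y ∈ (chartAt (Fin n → ℂ) x).source) :
    coordMetric g x y = formMatrix (fibreBasis (Pi.basisFun ℂ (Fin n))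
      (trivializationAt (Fin n → ℂ) (TangentSpace 𝓘(ℂ, Fin n → ℂ) : X → Type) x) hy) (g y) := by
  ext i j
  have hf := fun i => fibreBasis_apply (Pi.basisFun ℂ (Fin n))
    (trivializationAt (Fin n → ℂ) (TangentSpace 𝓘(ℂ, Fin n → ℂ) : X → Type) x) hy i
  exact (congrArg₂ (fun v w => g y v w) (hf i) (hf j)).symm

open scoped ComplexOrder in
theorem coordMetric_det_eq (hg : IsHermitianMetric (W := Fin n → ℂ) 𝓘(ℝ, Fin n → ℂ) g) (x : X)
    {y : X} (hy : y ∈ (chartAt (Fin n → ℂ) x).source) :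
    0 < (coordMetric g x y).det.re ∧ (coordMetric g x y).det = ((coordMetric g x y).det.re : ℂ) := by
  rw [coordMetric_eq_formMatrix g x hy]
  have := (formMatrix_posDef (hg.isPosHermitian y) (fibreBasis (Pi.basisFun ℂ (Fin n))
    (trivializationAt (Fin n → ℂ) (TangentSpace 𝓘(ℂ, Fin n → ℂ) : X → Type) x) hy)).det_pos
  rw [Complex.pos_iff] at this
  exact ⟨this.1, Complex.ext rfl (by simpa using this.2.symm)⟩

theorem continuousOn_coordMetric (hg : IsHermitianMetric (W := Fin n → ℂ) 𝓘(ℝ, Fin n → ℂ) g)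
    (x : X) : ContinuousOn (coordMetric g x) (chartAt (Fin n → ℂ) x).source :=
  continuousOn_pi.2 fun i => continuousOn_pi.2 fun j =>
    (hg.smooth (trivializationAt (Fin n → ℂ) (TangentSpace 𝓘(ℂ, Fin n → ℂ) : X → Type) x)
      (Pi.basisFun ℂ (Fin n) i) (Pi.basisFun ℂ (Fin n) j)).continuousOn

variable [CompactSpace X] [T2Space X]

/-- The real integrand in the chart around `x` of the integral of a real function. -/
def chartDensity (g : TangentForm n X) (r : X → ℝ) (x : X) (z : Fin n → ℂ) : ℝ :=
  chartPartition n X x ((chartAt (Fin n → ℂ) x).symm z) * r ((chartAt (Fin n → ℂ) x).symm z) *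
    (coordMetric g x ((chartAt (Fin n → ℂ) x).symm z)).det.re

theorem continuousOn_chartDensity
    (hg : IsHermitianMetric (W := Fin n → ℂ) 𝓘(ℝ, Fin n → ℂ) g) {r : X → ℝ} (hr : Continuous r)
    (x : X) : ContinuousOn (chartDensity g r x) (chartAt (Fin n → ℂ) x).target := by
  have h1 := (chartAt (Fin n → ℂ) x).continuousOn_symm
  have h2 : ContinuousOn (fun y => (coordMetric g x y).det.re) (chartAt (Fin n → ℂ) x).source :=
    Complex.continuous_re.comp_continuousOn
      ((continuous_id.matrix_det).comp_continuousOn (continuousOn_coordMetric hg x))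
  exact (((chartPartition n X x).continuous.comp_continuousOn h1).mul
    (hr.comp_continuousOn h1)).mul (h2.comp h1 (chartAt (Fin n → ℂ) x).mapsTo_symm)

theorem chartPartition_tsupport_subset (x : X) :
    tsupport (chartPartition n X x) ⊆ (chartAt (Fin n → ℂ) x).source :=
  Classical.choose_spec (exists_chart_partition n X) x

/-- The density is continuous on the chart and vanishes off the image of the support of the
partition function, which is compact. -/
theorem integrableOn_chartDensity
    (hg : IsHermitianMetric (W := Fin n → ℂ) 𝓘(ℝ, Fin n → ℂ) g) {r : X → ℝ} (hr : Continuous r)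
    (x : X) : IntegrableOn (chartDensity g r x) (chartAt (Fin n → ℂ) x).target := by
  have hsub := chartPartition_tsupport_subset (n := n) x
  have hK : IsCompact (chartAt (Fin n → ℂ) x '' tsupport (chartPartition n X x)) :=
    (isClosed_tsupport _).isCompact.image_of_continuousOn
      ((chartAt (Fin n → ℂ) x).continuousOn.mono hsub)
  have hKt : chartAt (Fin n → ℂ) x '' tsupport (chartPartition n X x) ⊆
      (chartAt (Fin n → ℂ) x).target := by
    rintro _ ⟨y, hy, rfl⟩
    exact (chartAt (Fin n → ℂ) x).map_source (hsub hy)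
  refine (((continuousOn_chartDensity hg hr x).mono hKt).integrableOn_compact hK
    ).of_forall_sdiff_eq_zero (chartAt (Fin n → ℂ) x).open_target.measurableSet fun z hz => ?_
  have : chartPartition n X x ((chartAt (Fin n → ℂ) x).symm z) = 0 := by
    by_contra hne
    exact hz.2 ⟨_, subset_tsupport _ hne, (chartAt (Fin n → ℂ) x).right_inv hz.1⟩
  simp [chartDensity, this]

theorem chartDensity_nonneg
    (hg : IsHermitianMetric (W := Fin n → ℂ) 𝓘(ℝ, Fin n → ℂ) g) {r : X → ℝ} (hr : ∀ x, 0 ≤ r x)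
    (x : X) {z : Fin n → ℂ} (hz : z ∈ (chartAt (Fin n → ℂ) x).target) :
    0 ≤ chartDensity g r x z :=
  mul_nonneg (mul_nonneg ((chartPartition n X).nonneg _ _) (hr _))
    (coordMetric_det_eq hg x ((chartAt (Fin n → ℂ) x).map_target hz)).1.le

theorem kaehlerIntegral_ofReal
    (hg : IsHermitianMetric (W := Fin n → ℂ) 𝓘(ℝ, Fin n → ℂ) g) (r : X → ℝ) :
    kaehlerIntegral g (fun x => (r x : ℂ)) =
      ∑ᶠ x : X, ((∫ z in (chartAt (Fin n → ℂ) x).target, chartDensity g r x z : ℝ) : ℂ) := by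
  refine finsum_congr fun x => ?_
  rw [← integral_complex_ofReal]
  refine setIntegral_congr_fun (chartAt (Fin n → ℂ) x).open_target.measurableSet fun z hz => ?_
  dsimp only [chartDensity]
  rw [(coordMetric_det_eq hg x ((chartAt (Fin n → ℂ) x).map_target hz)).2]
  simp

/-- A nonnegative continuous function with vanishing integral is zero. -/
theorem eq_zero_of_kaehlerIntegral_eq_zero
    (hg : IsHermitianMetric (W := Fin n → ℂ) 𝓘(ℝ, Fin n → ℂ) g) {r : X → ℝ} (hr : Continuous r)
    (hr0 : ∀ x, 0 ≤ r x) (h0 : kaehlerIntegral g (fun x => (r x : ℂ)) = 0) (y : X) : r y = 0 := by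
  -- `∑ᶠ` is zero by default when the support is infinite. By compactness only finitely many
  -- functions of the partition are nonzero, so the sum is genuine and each of its nonnegative terms
  -- vanishes.
  rw [kaehlerIntegral_ofReal hg] at h0
  have hfin : (Function.support fun x : X =>
      ((∫ z in (chartAt (Fin n → ℂ) x).target, chartDensity g r x z : ℝ) : ℂ)).Finite := by
    refine (chartPartition n X).locallyFinite.finite_nonempty_of_compact.subset fun x hx => ?_
    by_contra hne
    apply hx
    have : ∀ z, chartPartition n X x z = 0 := fun z => by
      by_contra h
      exact hne ⟨z, h⟩
    simp [chartDensity, this]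
  have hI : ∀ x, (∫ z in (chartAt (Fin n → ℂ) x).target, chartDensity g r x z) = 0 := by
    rw [finsum_eq_sum _ hfin, ← Complex.ofReal_sum, Complex.ofReal_eq_zero,
      Finset.sum_eq_zero_iff_of_nonneg fun x _ =>
        setIntegral_nonneg (chartAt (Fin n → ℂ) x).open_target.measurableSet
          fun z hz => chartDensity_nonneg hg hr0 x hz] at h0
    intro x
    by_contra hne
    exact hne (h0 x (by simpa using hne))
  obtain ⟨x, hx⟩ : ∃ x, chartPartition n X x y ≠ 0 := by
    by_contra! hne
    have := (chartPartition n X).sum_eq_one (mem_univ y)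
    simp [hne] at this
  have hyx := chartPartition_tsupport_subset (n := n) x (subset_tsupport _ hx)
  have hae := (setIntegral_eq_zero_iff_of_nonneg_ae
    ((ae_restrict_mem (chartAt (Fin n → ℂ) x).open_target.measurableSet).mono
      fun z hz => chartDensity_nonneg hg hr0 x hz) (integrableOn_chartDensity hg hr x)).1 (hI x)
  -- A continuous function on an open set that vanishes almost everywhere vanishes everywhere. At
  -- `y` the partition function and the determinant are nonzero, so `r y` is the factor that
  -- vanishes.
  have hzero := Measure.eqOn_open_of_ae_eq hae (chartAt (Fin n → ℂ) x).open_target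
    (continuousOn_chartDensity hg hr x) continuousOn_const
    ((chartAt (Fin n → ℂ) x).map_source hyx)
  simp only [chartDensity, (chartAt (Fin n → ℂ) x).left_inv hyx, Pi.zero_apply, mul_eq_zero, hx,
    (coordMetric_det_eq hg x hyx).1.ne', or_false, false_or] at hzero
  exact hzero

end Base

end

noncomputable section

open Filter Topology MeasureTheory

/-! ### Chart and frame independence of `∂̄` -/

section WirtingerComp

variable {E E' W W' : Type*} [NormedAddCommGroup E] [NormedSpace ℂ E] [NormedSpace ℝ E]
  [IsScalarTower ℝ ℂ E] [NormedAddCommGroup E'] [NormedSpace ℂ E'] [NormedSpace ℝ E']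
  [IsScalarTower ℝ ℂ E'] [NormedAddCommGroup W] [NormedSpace ℂ W] [NormedAddCommGroup W']
  [NormedSpace ℂ W']

/-- `∂̄` commutes with holomorphic multipliers and holomorphic substitutions. -/
theorem dBar_holomorphic_comp {T : E' → (W →L[ℂ] W')} {ψ : E' → E} {ψ' : E' →L[ℂ] E} {u : E → W}
    {z w : E'} (hT : DifferentiableAt ℂ T z) (hψ : HasFDerivAt ψ ψ' z)
    (hu : DifferentiableAt ℝ u (ψ z)) :
    dBar w (fun z => T z (u (ψ z))) z = T z (dBar (ψ' w) u (ψ z)) := by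
  have h1 : HasFDerivAt (fun z => u (ψ z)) ((fderiv ℝ u (ψ z)).comp (ψ'.restrictScalars ℝ)) z :=
    hu.hasFDerivAt.comp z (hψ.restrictScalars ℝ)
  have h2 : HasFDerivAt (fun z => (T z).restrictScalars ℝ)
      ((ContinuousLinearMap.restrictScalarsL ℂ W W' ℝ ℝ).comp
        ((fderiv ℂ T z).restrictScalars ℝ)) z :=
    (ContinuousLinearMap.restrictScalarsL ℂ W W' ℝ ℝ).hasFDerivAt.comp z
      (hT.hasFDerivAt.restrictScalars ℝ)
  have h3 := (h2.clm_apply h1).fderiv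
  simp only [ContinuousLinearMap.coe_restrictScalars'] at h3
  simp only [dBar, h3]
  simp [smul_smul, smul_add]
  module

theorem dBar_add_right (w w' : E) (u : E → W) (z : E) :
    dBar (w + w') u z = dBar w u z + dBar w' u z := by
  simp only [dBar, map_add, smul_add]
  module

theorem map_complex_smul (L : E →L[ℝ] W) (c : ℂ) (v : E) :
    L (c • v) = (c.re : ℂ) • L v + (c.im : ℂ) • L (Complex.I • v) := by
  have hE : ∀ (r : ℝ) (v : E), (r : ℂ) • v = r • v := fun r v => algebraMap_smul ℂ r v
  conv_lhs => rw [← Complex.re_add_im c]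
  rw [add_smul, map_add, mul_smul, hE, hE, map_smul, map_smul, Complex.coe_smul, Complex.coe_smul]

theorem dBar_smul_right (c : ℂ) (w : E) (u : E → W) (z : E) :
    dBar (c • w) u z = conj c • dBar w u z := by
  have hc : conj c = c.re - c.im * Complex.I := by
    apply Complex.ext <;> simp
  rw [dBar, dBar, smul_comm Complex.I c w, map_complex_smul, map_complex_smul _ c (Complex.I • w),
    smul_smul Complex.I Complex.I w, Complex.I_mul_I, neg_one_smul, map_neg, hc]
  match_scalars
  · ring
  · linear_combination ((c.im : ℂ) / 2) * Complex.I_mul_I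

/-- A real differentiable function with `∂̄ u = 0` is complex differentiable. -/
theorem differentiableAt_of_dBar_eq_zero {u : E → W} {z : E} (hu : DifferentiableAt ℝ u z)
    (h : ∀ w, dBar w u z = 0) : DifferentiableAt ℂ u z := by
  -- The equation `∂̄_w u = 0`, multiplied by `i`, says that the real derivative commutes with `i`.
  have h1 : ∀ w, fderiv ℝ u z (Complex.I • w) = Complex.I • fderiv ℝ u z w := fun w => by
    have h2 := (smul_eq_zero.1 (h w)).resolve_left (by norm_num)
    have h3 := congrArg (fun v => Complex.I • v) h2
    simp only [smul_add, smul_smul, Complex.I_mul_I, smul_zero, neg_one_smul] at h3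
    exact (sub_eq_zero.1 (by rw [sub_eq_add_neg]; exact h3)).symm
  let L : E →L[ℂ] W :=
    { toFun := fderiv ℝ u z
      map_add' := map_add _
      map_smul' := fun c w => by
        rw [RingHom.id_apply]
        conv_rhs => rw [← Complex.re_add_im c]
        exact (map_complex_smul _ c w).trans (by rw [h1, add_smul, mul_smul])
      cont := (fderiv ℝ u z).continuous }
  exact (hasFDerivAt_of_restrictScalars ℝ hu.hasFDerivAt
    (show L.restrictScalars ℝ = fderiv ℝ u z from rfl)).differentiableAt

end WirtingerComp

section Dbar

variable {n m : ℕ} {X S : Type*} [TopologicalSpace X] [ChartedSpace (Fin n → ℂ) X]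
  [IsManifold 𝓘(ℂ, Fin n → ℂ) ω X]
  [TopologicalSpace S] [ChartedSpace (Fin m → ℂ) S]
  {W : Type*} [NormedAddCommGroup W] [NormedSpace ℂ W]
  {E : X × S → Type*} [TopologicalSpace (TotalSpace W E)]
  [∀ p, AddCommGroup (E p)] [∀ p, Module ℂ (E p)] [∀ p, TopologicalSpace (E p)]
  [FiberBundle W E] {s : S} {η : ∀ x : X, E (x, s)}

variable (W) in
/-- A section of `E_s` in the preferred trivialization and chart around `x`. -/
def localSection (s : S) (η : ∀ x : X, E (x, s)) (x : X) (z : Fin n → ℂ) : W :=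
  (trivializationAt W E (x, s)
    ⟨((chartAt (Fin n → ℂ) x).symm z, s), η ((chartAt (Fin n → ℂ) x).symm z)⟩).2

theorem dbarSection_eq (x : X) (β : Fin n) : dbarSection W s η x β =
    (trivializationAt W E (x, s)).symm (x, s)
      (dBar (Pi.single β 1) (localSection W s η x) (chartAt (Fin n → ℂ) x x)) := rfl

theorem IsSmoothSection.contDiffAt_localSection (hη : IsSmoothSection n m W s η) (x : X) :
    ContDiffAt ℝ ∞ (localSection W s η x) (chartAt (Fin n → ℂ) x x) := by
  have h1 := (contMDiffAt_iff.1 (contMDiffAt_totalSpace.1 (hη x)).2).2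
  exact h1.contDiffAt (by simp)

variable [VectorBundle ℂ W E]

/-- The local representatives differ by a holomorphic multiplier and a holomorphic substitution, the
form that `dBar_holomorphic_comp` requires. -/
theorem localSection_eventuallyEq {x y : X} (hy : y ∈ (chartAt (Fin n → ℂ) x).source)
    (hy' : (y, s) ∈ (trivializationAt W E (x, s)).baseSet) :
    localSection W s η y =ᶠ[𝓝 (chartAt (Fin n → ℂ) y y)] fun z =>
      (trivializationAt W E (x, s)).coordChangeL ℂ (trivializationAt W E (y, s))
        ((chartAt (Fin n → ℂ) y).symm z, s)
        (localSection W s η x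
          (chartAt (Fin n → ℂ) x ((chartAt (Fin n → ℂ) y).symm z))) := by
  have hc : ContinuousAt (chartAt (Fin n → ℂ) y).symm (chartAt (Fin n → ℂ) y y) :=
    (chartAt (Fin n → ℂ) y).symm.continuousAt (mem_chart_target _ y)
  have h0 : (chartAt (Fin n → ℂ) y).symm (chartAt (Fin n → ℂ) y y) = y :=
    (chartAt (Fin n → ℂ) y).left_inv (mem_chart_source _ y)
  have h1 : ∀ᶠ z in 𝓝 (chartAt (Fin n → ℂ) y y),
      (chartAt (Fin n → ℂ) y).symm z ∈ (chartAt (Fin n → ℂ) x).source :=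
    hc.eventually_mem (by rw [h0]; exact (chartAt (Fin n → ℂ) x).open_source.mem_nhds hy)
  have h2 : ∀ᶠ z in 𝓝 (chartAt (Fin n → ℂ) y y), ((chartAt (Fin n → ℂ) y).symm z, s) ∈
      (trivializationAt W E (x, s)).baseSet ∩ (trivializationAt W E (y, s)).baseSet :=
    (hc.prodMk continuousAt_const).eventually_mem (by
      rw [h0]
      exact ((trivializationAt W E (x, s)).open_baseSet.inter
        (trivializationAt W E (y, s)).open_baseSet).mem_nhds
          ⟨hy', mem_baseSet_trivializationAt W E (y, s)⟩)
  filter_upwards [h1, h2] with z hz hz'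
  rw [Trivialization.coordChangeL_apply _ _ hz', localSection, localSection,
    (chartAt (Fin n → ℂ) x).left_inv hz, Trivialization.symm_apply_apply_mk _ hz'.1]

theorem differentiableAt_coordChangeL
    (hE : ContMDiffVectorBundle ω W E (𝓘(ℂ, Fin n → ℂ).prod 𝓘(ℂ, Fin m → ℂ))) {x y : X}
    (hy' : (y, s) ∈ (trivializationAt W E (x, s)).baseSet) :
    DifferentiableAt ℂ (fun z : Fin n → ℂ =>
      ((trivializationAt W E (x, s)).coordChangeL ℂ (trivializationAt W E (y, s))
        ((chartAt (Fin n → ℂ) y).symm z, s) : W →L[ℂ] W)) (chartAt (Fin n → ℂ) y y) := by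
  have h0 : (chartAt (Fin n → ℂ) y).symm (chartAt (Fin n → ℂ) y y) = y :=
    (chartAt (Fin n → ℂ) y).left_inv (mem_chart_source _ y)
  have h1 : ContMDiffAt (𝓘(ℂ, Fin n → ℂ).prod 𝓘(ℂ, Fin m → ℂ)) 𝓘(ℂ, W →L[ℂ] W) ω
      (fun b : X × S => ((trivializationAt W E (x, s)).coordChangeL ℂ
        (trivializationAt W E (y, s)) b : W →L[ℂ] W)) (y, s) :=
    contMDiffAt_coordChangeL hy' (mem_baseSet_trivializationAt W E (y, s))
  have h2 : ContMDiffAt 𝓘(ℂ, Fin n → ℂ) (𝓘(ℂ, Fin n → ℂ).prod 𝓘(ℂ, Fin m → ℂ)) ω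
      (fun z : Fin n → ℂ => ((chartAt (Fin n → ℂ) y).symm z, s)) (chartAt (Fin n → ℂ) y y) :=
    ((contMDiffOn_chart_symm (I := 𝓘(ℂ, Fin n → ℂ)) (x := y)).contMDiffAt
      ((chartAt (Fin n → ℂ) y).open_target.mem_nhds (mem_chart_target _ y))).prodMk
      contMDiffAt_const
  have h3 := ContMDiffAt.comp (chartAt (Fin n → ℂ) y y) (g := fun b : X × S =>
    ((trivializationAt W E (x, s)).coordChangeL ℂ (trivializationAt W E (y, s)) b : W →L[ℂ] W))
    (f := fun z : Fin n → ℂ => ((chartAt (Fin n → ℂ) y).symm z, s)) (by rw [h0]; exact h1) h2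
  exact (contMDiffAt_iff_contDiffAt.1 h3).differentiableAt (by simp)

theorem hasFDerivAt_chart_transition {x y : X} (hy : y ∈ (chartAt (Fin n → ℂ) x).source) :
    HasFDerivAt (fun z => chartAt (Fin n → ℂ) x ((chartAt (Fin n → ℂ) y).symm z))
      (tangentCoordChange 𝓘(ℂ, Fin n → ℂ) y x y) (chartAt (Fin n → ℂ) y y) := by
  have := hasFDerivWithinAt_tangentCoordChange (I := 𝓘(ℂ, Fin n → ℂ)) (x := y) (y := x) (z := y)
    ⟨mem_extChartAt_source y, by simpa using hy⟩
  exact this.hasFDerivAt (by simp)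

/-- The `(0,1)`-form `∂̄η` does not depend on the chart and the trivialization. -/
theorem dBar_localSection
    (hE : ContMDiffVectorBundle ω W E (𝓘(ℂ, Fin n → ℂ).prod 𝓘(ℂ, Fin m → ℂ))) {x y : X} (hy : y ∈ (chartAt (Fin n → ℂ) x).source)
    (hy' : (y, s) ∈ (trivializationAt W E (x, s)).baseSet)
    (hd : DifferentiableAt ℝ (localSection W s η x) (chartAt (Fin n → ℂ) x y)) (w : Fin n → ℂ) :
    (trivializationAt W E (y, s)).symm (y, s)
      (dBar w (localSection W s η y) (chartAt (Fin n → ℂ) y y)) =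
    (trivializationAt W E (x, s)).symm (y, s)
      (dBar (tangentCoordChange 𝓘(ℂ, Fin n → ℂ) y x y w) (localSection W s η x)
        (chartAt (Fin n → ℂ) x y)) := by
  have h0 : (chartAt (Fin n → ℂ) y).symm (chartAt (Fin n → ℂ) y y) = y :=
    (chartAt (Fin n → ℂ) y).left_inv (mem_chart_source _ y)
  have hmem := mem_baseSet_trivializationAt W E (y, s)
  refine (congrArg _ (dBar_congr (localSection_eventuallyEq hy hy'))).trans ?_
  refine (congrArg _ (dBar_holomorphic_comp (differentiableAt_coordChangeL hE hy')
    (hasFDerivAt_chart_transition hy) (by rw [h0]; exact hd))).trans ?_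
  rw [h0, ContinuousLinearEquiv.coe_coe, Trivialization.coordChangeL_apply _ _ ⟨hy', hmem⟩,
    Trivialization.symm_apply_apply_mk _ hmem]

end Dbar

end

noncomputable section

open Filter Topology MeasureTheory

/-! ### The energy of `∂̄η` and the holomorphy of harmonic sections -/

theorem continuousAt_dBar {E W : Type*} [NormedAddCommGroup E] [NormedSpace ℂ E] [NormedSpace ℝ E]
    [NormedAddCommGroup W] [NormedSpace ℂ W] {u : E → W} {z : E} (hu : ContDiffAt ℝ 1 u z) (w : E) :
    ContinuousAt (dBar w u) z := by
  have h1 : ContinuousAt (fderiv ℝ u) z :=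
    (hu.fderiv_right (m := 0) (by norm_num)).continuousAt
  unfold dBar
  exact ((h1.clm_apply continuousAt_const).add
    ((h1.clm_apply continuousAt_const).const_smul Complex.I)).const_smul (1 / 2 : ℂ)

section Density

variable {n m : ℕ} {X S : Type*} [TopologicalSpace X] [ChartedSpace (Fin n → ℂ) X]
  [IsManifold 𝓘(ℂ, Fin n → ℂ) ω X]
  [TopologicalSpace S] [ChartedSpace (Fin m → ℂ) S]
  {W : Type*} [NormedAddCommGroup W] [NormedSpace ℂ W]
  {E : X × S → Type*} [TopologicalSpace (TotalSpace W E)]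
  [∀ p, AddCommGroup (E p)] [∀ p, Module ℂ (E p)] [∀ p, TopologicalSpace (E p)]
  [FiberBundle W E] {g : TangentForm n X} {h : SesqForm E} {s : S} {η : ∀ x : X, E (x, s)}

theorem eventually_mem_baseSet_fibre (x : X) :
    ∀ᶠ y in 𝓝 x, (y, s) ∈ (trivializationAt W E (x, s)).baseSet :=
  (continuous_id.prodMk continuous_const).continuousAt.eventually_mem
    ((trivializationAt W E (x, s)).open_baseSet.mem_nhds (mem_baseSet_trivializationAt W E (x, s)))

variable [VectorBundle ℂ W E]

theorem continuousAt_form_symm [FiniteDimensional ℂ W]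
    (hh : IsHermitianMetric (W := W) (𝓘(ℝ, Fin n → ℂ).prod 𝓘(ℝ, Fin m → ℂ)) h) {x : X}
    {d d' : X → W} (hd : ContinuousAt d x) (hd' : ContinuousAt d' x) :
    ContinuousAt (fun y => h (y, s) ((trivializationAt W E (x, s)).symm (y, s) (d y))
      ((trivializationAt W E (x, s)).symm (y, s) (d' y))) x := by
  let b := Module.finBasis ℂ W
  let e := trivializationAt W E (x, s)
  have key : (fun y => h (y, s) (e.symm (y, s) (d y)) (e.symm (y, s) (d' y))) =ᶠ[𝓝 x]
      fun y => ∑ i, ∑ j, b.coord i (d y) * (conj (b.coord j (d' y)) *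
        h (y, s) (e.symm (y, s) (b i)) (e.symm (y, s) (b j))) := by
    filter_upwards [eventually_mem_baseSet_fibre (W := W) (E := E) (s := s) x] with y hy
    conv_lhs => rw [← b.sum_repr (d y), ← b.sum_repr (d' y)]
    simp only [← Trivialization.symmL_apply (R := ℂ) e hy, map_sum, map_smul, LinearMap.sum_apply,
      LinearMap.smul_apply, map_smulₛₗ, smul_eq_mul, Finset.mul_sum, Module.Basis.coord_apply]
    rw [Finset.sum_comm]
    refine Finset.sum_congr rfl fun i _ => Finset.sum_congr rfl fun j _ => ?_
    ring
  refine ContinuousAt.congr ?_ key.symm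
  have hcoord : ∀ i, Continuous (b.coord i) := fun i =>
    LinearMap.continuous_of_finiteDimensional _
  refine tendsto_finsetSum _ fun i _ => tendsto_finsetSum _ fun j _ => ?_
  refine Tendsto.mul ((hcoord i).continuousAt.comp hd) (Tendsto.mul
    (Complex.continuous_conj.continuousAt.comp ((hcoord j).continuousAt.comp hd')) ?_)
  have h1 := ((hh.smooth e (b i) (b j)).continuousOn.continuousAt
    (e.open_baseSet.mem_nhds (mem_baseSet_trivializationAt W E (x, s))))
  exact ContinuousAt.comp (f := fun y : X => (y, s)) (x := x) h1
    (continuous_id.prodMk continuous_const).continuousAt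

theorem IsSmoothSection.continuous_form [FiniteDimensional ℂ W]
    (hh : IsHermitianMetric (W := W) (𝓘(ℝ, Fin n → ℂ).prod 𝓘(ℝ, Fin m → ℂ)) h)
    (hη : IsSmoothSection n m W s η) : Continuous fun y => h (y, s) (η y) (η y) := by
  refine continuous_iff_continuousAt.2 fun x => ?_
  have h1 : ContinuousAt (fun y => (trivializationAt W E (x, s) ⟨(y, s), η y⟩).2) x :=
    (contMDiffAt_totalSpace.1 (hη x)).2.continuousAt
  refine (continuousAt_form_symm (s := s) hh h1 h1).congr ?_
  filter_upwards [eventually_mem_baseSet_fibre (W := W) (E := E) (s := s) x] with y hy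
  rw [Trivialization.symm_apply_apply_mk _ hy]

variable (W) in
/-- The conjugate linear map `w ↦ ∂̄_w η` on the tangent space at `y`. -/
def dbarMap (s : S) (η : ∀ x : X, E (x, s)) (y : X) :
    TangentSpace 𝓘(ℂ, Fin n → ℂ) y →ₗ⋆[ℂ] E (y, s) where
  toFun w := (trivializationAt W E (y, s)).symmL ℂ (y, s)
    (dBar (E := Fin n → ℂ) w (localSection W s η y) (chartAt (Fin n → ℂ) y y))
  map_add' w w' := by
    rw [← map_add]
    exact congrArg _ (dBar_add_right (E := Fin n → ℂ) w w' _ _)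
  map_smul' c w := by
    rw [← map_smul]
    exact congrArg _ (dBar_smul_right (E := Fin n → ℂ) c w _ _)

theorem dbarMap_apply (y : X) (w : TangentSpace 𝓘(ℂ, Fin n → ℂ) y) : dbarMap W s η y w =
    (trivializationAt W E (y, s)).symm (y, s)
      (dBar (E := Fin n → ℂ) w (localSection W s η y) (chartAt (Fin n → ℂ) y y)) :=
  Trivialization.symmL_apply _ (mem_baseSet_trivializationAt W E (y, s)) _

variable (n X) in
/-- The basis of the tangent space at `y` that the chart around `x` gives. -/
def chartBasis (x : X) {y : X} (hy : y ∈ (chartAt (Fin n → ℂ) x).source) :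
    Module.Basis (Fin n) ℂ (TangentSpace 𝓘(ℂ, Fin n → ℂ) y) :=
  fibreBasis (Pi.basisFun ℂ (Fin n))
    (trivializationAt (Fin n → ℂ) (TangentSpace 𝓘(ℂ, Fin n → ℂ) : X → Type) x) hy

theorem chartBasis_apply (x : X) {y : X} (hy : y ∈ (chartAt (Fin n → ℂ) x).source) (b : Fin n) :
    chartBasis n X x hy b = tangentCoordChange 𝓘(ℂ, Fin n → ℂ) x y y (Pi.single b 1) := by
  refine (fibreBasis_apply (Pi.basisFun ℂ (Fin n))
    (trivializationAt (Fin n → ℂ) (TangentSpace 𝓘(ℂ, Fin n → ℂ) : X → Type) x) hy b).trans ?_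
  rw [Pi.basisFun_apply,
    ← Trivialization.symmL_apply (R := ℂ)
      (trivializationAt (Fin n → ℂ) (TangentSpace 𝓘(ℂ, Fin n → ℂ) : X → Type) x) hy,
    TangentBundle.symmL_trivializationAt_eq_core hy]
  rfl

/-- `dbarMap` uses the chart and frame at the moving point `y`, which need not vary continuously
with `y`. Here `∂̄η` is expressed by the fixed chart and frame at `x`. -/
theorem dbarMap_chartBasis
    (hE : ContMDiffVectorBundle ω W E (𝓘(ℂ, Fin n → ℂ).prod 𝓘(ℂ, Fin m → ℂ))) {x y : X}
    (hy : y ∈ (chartAt (Fin n → ℂ) x).source)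
    (hy' : (y, s) ∈ (trivializationAt W E (x, s)).baseSet)
    (hd : DifferentiableAt ℝ (localSection W s η x) (chartAt (Fin n → ℂ) x y)) (b : Fin n) :
    dbarMap W s η y (chartBasis n X x hy b) = (trivializationAt W E (x, s)).symm (y, s)
      (dBar (Pi.single b 1) (localSection W s η x) (chartAt (Fin n → ℂ) x y)) := by
  have h1 := dBar_localSection hE hy hy' hd (chartBasis n X x hy b)
  have h2 : tangentCoordChange 𝓘(ℂ, Fin n → ℂ) y x y (chartBasis n X x hy b) = Pi.single b 1 := by
    rw [chartBasis_apply, tangentCoordChange_comp, tangentCoordChange_self]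
    · simpa using hy
    · exact ⟨⟨by simpa using hy, mem_extChartAt_source y⟩, by simpa using hy⟩
  rw [h2] at h1
  rw [dbarMap_apply]
  exact h1

theorem chartBasis_self (y : X) (b : Fin n) :
    chartBasis n X y (mem_chart_source _ y) b = (Pi.single b 1 : Fin n → ℂ) := by
  rw [chartBasis_apply, tangentCoordChange_self (mem_extChartAt_source y)]

theorem dbarMap_chartBasis_self (y : X) (b : Fin n) :
    dbarMap W s η y (chartBasis n X y (mem_chart_source _ y) b) = dbarSection W s η y b := by
  rw [dbarMap_apply, dbarSection_eq, chartBasis_self]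

variable (W) in
/-- The pointwise square norm of `∂̄η`. -/
def dbarDensity (g : TangentForm n X) (h : SesqForm E) (s : S) (η : ∀ x : X, E (x, s)) (y : X) : ℂ :=
  contraction (g y) (formConjComp (h (y, s)) (dbarMap W s η y))
    (chartBasis n X y (mem_chart_source _ y))

theorem dbarDensity_eq (hg : IsHermitianMetric (W := Fin n → ℂ) 𝓘(ℝ, Fin n → ℂ) g) (x : X) {y : X}
    (hy : y ∈ (chartAt (Fin n → ℂ) x).source) : dbarDensity W g h s η y =
      ∑ b, ∑ a, (coordMetric g x y)⁻¹ b a * h (y, s) (dbarMap W s η y (chartBasis n X x hy b))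
        (dbarMap W s η y (chartBasis n X x hy a)) := by
  rw [dbarDensity, contraction_congr_basis (hg.isPosHermitian y) _ (chartBasis n X x hy),
    contraction, Finset.sum_comm, coordMetric_eq_formMatrix g x hy]
  rfl

theorem l2Product_dbarSection [CompactSpace X] [T2Space X]
    (hg : IsHermitianMetric (W := Fin n → ℂ) 𝓘(ℝ, Fin n → ℂ) g) :
    l2Product g h s (q := 1) (fun x b => dbarSection W s η x (b 0))
      (fun x b => dbarSection W s η x (b 0)) = kaehlerIntegral g (dbarDensity W g h s η) := by
  unfold l2Product
  congr 1
  funext y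
  rw [dbarDensity_eq hg y (mem_chart_source _ y), Nat.factorial_one, Nat.cast_one, one_div_one,
    one_mul]
  refine Fintype.sum_equiv (Equiv.funUnique (Fin 1) (Fin n)) _ _ fun b => ?_
  refine Fintype.sum_equiv (Equiv.funUnique (Fin 1) (Fin n)) _ _ fun a => ?_
  rw [dbarMap_chartBasis_self, dbarMap_chartBasis_self]
  simp

theorem l2Section_eq [CompactSpace X] [T2Space X] (σ η : ∀ x : X, E (x, s)) :
    l2Section g h s σ η = kaehlerIntegral g fun x => h (x, s) (σ x) (η x) := by
  simp [l2Section, l2Product]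

theorem exists_dbarDensity_eq_sum (hg : IsHermitianMetric (W := Fin n → ℂ) 𝓘(ℝ, Fin n → ℂ) g)
    (h : SesqForm E) (y : X) : ∃ b : Module.Basis (Fin (Module.finrank ℂ
      (TangentSpace 𝓘(ℂ, Fin n → ℂ) y))) ℂ (TangentSpace 𝓘(ℂ, Fin n → ℂ) y),
      dbarDensity W g h s η y = ∑ i, h (y, s) (dbarMap W s η y (b i)) (dbarMap W s η y (b i)) := by
  obtain ⟨b, hb⟩ := exists_contraction_eq_sum (hg.isPosHermitian y)
    (chartBasis n X y (mem_chart_source _ y))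
  exact ⟨b, hb _⟩

/-- Frame independence of the contraction allows the fixed chart at `x` for all nearby points; there
every ingredient is continuous. -/
theorem continuous_dbarDensity [FiniteDimensional ℂ W]
    (hE : ContMDiffVectorBundle ω W E (𝓘(ℂ, Fin n → ℂ).prod 𝓘(ℂ, Fin m → ℂ)))
    (hg : IsHermitianMetric (W := Fin n → ℂ) 𝓘(ℝ, Fin n → ℂ) g)
    (hh : IsHermitianMetric (W := W) (𝓘(ℝ, Fin n → ℂ).prod 𝓘(ℝ, Fin m → ℂ)) h)
    (hη : IsSmoothSection n m W s η) : Continuous (dbarDensity W g h s η) := by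
  refine continuous_iff_continuousAt.2 fun x => ?_
  have hc : ContinuousAt (chartAt (Fin n → ℂ) x) x :=
    (chartAt (Fin n → ℂ) x).continuousAt (mem_chart_source _ x)
  have hu := hη.contDiffAt_localSection x
  have hd : ∀ᶠ y in 𝓝 x, DifferentiableAt ℝ (localSection W s η x) (chartAt (Fin n → ℂ) x y) := by
    have h1 : ContDiffAt ℝ 1 (localSection W s η x) (chartAt (Fin n → ℂ) x x) :=
      hu.of_le (by exact_mod_cast le_top)
    exact (hc.eventually (h1.eventually (by simp))).mono
      fun y hy => hy.differentiableAt one_ne_zero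
  have key : dbarDensity W g h s η =ᶠ[𝓝 x] fun y => ∑ b, ∑ a, (coordMetric g x y)⁻¹ b a *
      h (y, s) ((trivializationAt W E (x, s)).symm (y, s)
        (dBar (Pi.single b 1) (localSection W s η x) (chartAt (Fin n → ℂ) x y)))
      ((trivializationAt W E (x, s)).symm (y, s)
        (dBar (Pi.single a 1) (localSection W s η x) (chartAt (Fin n → ℂ) x y))) := by
    filter_upwards [hd, eventually_mem_baseSet_fibre (W := W) (E := E) (s := s) x,
      (chartAt (Fin n → ℂ) x).open_source.mem_nhds (mem_chart_source _ x)] with y hyd hyb hys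
    rw [dbarDensity_eq hg x hys]
    simp only [dbarMap_chartBasis hE hys hyb hyd]
  refine ContinuousAt.congr ?_ key.symm
  refine tendsto_finsetSum _ fun b _ => tendsto_finsetSum _ fun a _ => Tendsto.mul ?_ ?_
  · exact (contMDiffOn_formMatrix_inv hg (Pi.basisFun ℂ (Fin n))
      (trivializationAt (Fin n → ℂ) (TangentSpace 𝓘(ℂ, Fin n → ℂ) : X → Type) x) b
        a).continuousOn.continuousAt
        ((chartAt (Fin n → ℂ) x).open_source.mem_nhds (mem_chart_source _ x))
  · have h2 : ∀ b : Fin n, ContinuousAt (fun y => dBar (Pi.single b 1) (localSection W s η x)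
        (chartAt (Fin n → ℂ) x y)) x := fun b =>
      ContinuousAt.comp (g := dBar (Pi.single b 1) (localSection W s η x))
        (f := chartAt (Fin n → ℂ) x) (continuousAt_dBar (hu.of_le (by exact_mod_cast le_top)) _) hc
    exact continuousAt_form_symm hh (h2 b) (h2 a)

variable [CompactSpace X] [T2Space X]

/-- In a `g`-orthonormal basis the density is a sum of square norms of the `∂̄_{b_i} η`. A
continuous nonnegative density with integral zero vanishes, and so does each summand. -/
theorem dbarMap_eq_zero_of_l2Product_eq_zero [FiniteDimensional ℂ W]
    (hE : ContMDiffVectorBundle ω W E (𝓘(ℂ, Fin n → ℂ).prod 𝓘(ℂ, Fin m → ℂ)))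
    (hg : IsHermitianMetric (W := Fin n → ℂ) 𝓘(ℝ, Fin n → ℂ) g)
    (hh : IsHermitianMetric (W := W) (𝓘(ℝ, Fin n → ℂ).prod 𝓘(ℝ, Fin m → ℂ)) h)
    (hη : IsSmoothSection n m W s η)
    (h0 : l2Product g h s (q := 1) (fun x b => dbarSection W s η x (b 0))
      (fun x b => dbarSection W s η x (b 0)) = 0) (y : X) : dbarMap (n := n) W s η y = 0 := by
  rw [l2Product_dbarSection hg] at h0
  have hre : ∀ y, dbarDensity W g h s η y = ((dbarDensity W g h s η y).re : ℂ) := fun y => by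
    obtain ⟨b, hb⟩ := exists_dbarDensity_eq_sum (W := W) (η := η) hg h y
    rw [hb, Complex.re_sum, Complex.ofReal_sum]
    exact Finset.sum_congr rfl fun i _ => (hh.isPosHermitian (y, s)).self_eq_re _
  have hnn : ∀ y, 0 ≤ (dbarDensity W g h s η y).re := fun y => by
    obtain ⟨b, hb⟩ := exists_dbarDensity_eq_sum (W := W) (η := η) hg h y
    rw [hb, Complex.re_sum]
    exact Finset.sum_nonneg fun i _ => (hh.isPosHermitian (y, s)).self_nonneg _
  rw [funext hre] at h0
  have hz := eq_zero_of_kaehlerIntegral_eq_zero hg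
    (Complex.continuous_re.comp (continuous_dbarDensity hE hg hh hη)) hnn h0 y
  obtain ⟨b, hb⟩ := exists_dbarDensity_eq_sum (W := W) (η := η) hg h y
  rw [Function.comp_apply, hb, Complex.re_sum, Finset.sum_eq_zero_iff_of_nonneg
    fun i _ => (hh.isPosHermitian (y, s)).self_nonneg _] at hz
  exact b.ext fun i => (hh.isPosHermitian (y, s)).self_eq_zero (hz i (Finset.mem_univ i))

/-- Harmonic sections are holomorphic. -/
theorem IsHarmonicSection.differentiableAt_localSection [FiniteDimensional ℂ W]
    (hE : ContMDiffVectorBundle ω W E (𝓘(ℂ, Fin n → ℂ).prod 𝓘(ℂ, Fin m → ℂ)))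
    (hg : IsHermitianMetric (W := Fin n → ℂ) 𝓘(ℝ, Fin n → ℂ) g)
    (hh : IsHermitianMetric (W := W) (𝓘(ℝ, Fin n → ℂ).prod 𝓘(ℝ, Fin m → ℂ)) h)
    (hη : IsHarmonicSection m W g h s η) (x : X) :
    DifferentiableAt ℂ (localSection W s η x) (chartAt (Fin n → ℂ) x x) := by
  -- Testing the weak equation `□η = 0` with `η` itself gives `‖∂̄η‖² = 0`.
  have h0 := hη.2.2 η hη.1
  have hzero : l2Section g h s (fun _ => 0) η = 0 := by
    simp [l2Section_eq, kaehlerIntegral]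
  rw [hzero] at h0
  have hmap := dbarMap_eq_zero_of_l2Product_eq_zero hE hg hh hη.1 h0.symm x
  refine differentiableAt_of_dBar_eq_zero
    ((hη.1.contDiffAt_localSection x).differentiableAt (by simp)) fun w => ?_
  have h1 := LinearMap.congr_fun hmap (w : TangentSpace 𝓘(ℂ, Fin n → ℂ) x)
  exact ((trivializationAt W E (x, s)).linearEquivAt ℂ (x, s)
    (mem_baseSet_trivializationAt W E (x, s))).symm.map_eq_zero_iff.1
      ((dbarMap_apply x w).symm.trans h1)

theorem eq_zero_of_l2Section_self_eq_zero [FiniteDimensional ℂ W]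
    (hg : IsHermitianMetric (W := Fin n → ℂ) 𝓘(ℝ, Fin n → ℂ) g)
    (hh : IsHermitianMetric (W := W) (𝓘(ℝ, Fin n → ℂ).prod 𝓘(ℝ, Fin m → ℂ)) h)
    (hη : IsSmoothSection n m W s η) (h0 : l2Section g h s η η = 0) (x : X) : η x = 0 := by
  rw [l2Section_eq, funext fun x => (hh.isPosHermitian (x, s)).self_eq_re (η x)] at h0
  exact (hh.isPosHermitian (x, s)).self_eq_zero (eq_zero_of_kaehlerIntegral_eq_zero hg
    (Complex.continuous_re.comp (hη.continuous_form hh))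
    (fun x => (hh.isPosHermitian (x, s)).self_nonneg _) h0 x)

end Density

end

noncomputable section

open Filter Topology MeasureTheory

/-! ### Holomorphic sections and contraction in trivializations -/

section Holomorphic

variable {n m : ℕ} {X S : Type*} [TopologicalSpace X] [ChartedSpace (Fin n → ℂ) X]
  [TopologicalSpace S] [ChartedSpace (Fin m → ℂ) S]
  {W : Type*} [NormedAddCommGroup W] [NormedSpace ℂ W]
  {E : X × S → Type*} [TopologicalSpace (TotalSpace W E)]
  [∀ p, AddCommGroup (E p)] [∀ p, Module ℂ (E p)] [∀ p, TopologicalSpace (E p)]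
  [FiberBundle W E]

theorem contDiffAt_localForm {h : SesqForm E}
    (hh : IsHermitianMetric (W := W) (𝓘(ℝ, Fin n → ℂ).prod 𝓘(ℝ, Fin m → ℂ)) h) (p : X × S)
    (a c : W) :
    ContDiffAt ℝ 2 (fun z => localForm W (𝓘(ℂ, Fin n → ℂ).prod 𝓘(ℂ, Fin m → ℂ)) h p z a c)
      (extChartAt (𝓘(ℂ, Fin n → ℂ).prod 𝓘(ℂ, Fin m → ℂ)) p p) := by
  have h1 := (hh.smooth (trivializationAt W E p) a c).contMDiffAt
    ((trivializationAt W E p).open_baseSet.mem_nhds (mem_baseSet_trivializationAt W E p))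
  have h2 := (contMDiffAt_iff.1 h1).2
  rw [ModelWithCorners.range_eq_univ, contDiffWithinAt_univ] at h2
  exact h2.of_le (WithTop.coe_le_coe.2 (le_top : (2 : ℕ∞) ≤ ⊤))

theorem isHolomorphicSection_of_differentiableAt {s : S} {η : ∀ x : X, E (x, s)}
    (hc : ∀ x, ContinuousAt (fun y => (trivializationAt W E (x, s) ⟨(y, s), η y⟩).2) x)
    (hd : ∀ x, DifferentiableAt ℂ (localSection W s η x) (chartAt (Fin n → ℂ) x x)) :
    IsHolomorphicSection n m W s η := by
  intro x
  refine (mdifferentiableAt_totalSpace _ _).2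
    ⟨mdifferentiableAt_id.prodMk mdifferentiableAt_const, ?_⟩
  refine mdifferentiableAt_iff _ _ |>.2 ⟨hc x, ?_⟩
  exact (hd x).differentiableWithinAt

variable [VectorBundle ℂ W E] [FiniteDimensional ℂ W]
  [∀ p, IsTopologicalAddGroup (E p)] [∀ p, ContinuousSMul ℂ (E p)]

/-- The induced trivializations act by conjugation with that of `E`, so naturality turns the
fibrewise contraction into one fixed linear map on the typical fibre. -/
theorem endContraction_trivializationAt [∀ p, T2Space (E p)] [∀ p, FiniteDimensional ℂ (E p)]
    (p₀ : X × S) {p : X × S} (hp : p ∈ (trivializationAt W E p₀).baseSet)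
    (η : (E p →L[ℂ] E p) →L[ℂ] (E p →L[ℂ] E p)) :
    (trivializationAt (W →L[ℂ] W) (EndBundle E) p₀ ⟨p, endContraction η⟩).2 =
      endContraction ((trivializationAt ((W →L[ℂ] W) →L[ℂ] (W →L[ℂ] W))
        (EndBundle (EndBundle E)) p₀ ⟨p, η⟩).2) := by
  let e := (trivializationAt W E p₀).continuousLinearEquivAt ℂ p hp
  have he : ∀ A : E p →L[ℂ] E p, (trivializationAt (W →L[ℂ] W) (EndBundle E) p₀ ⟨p, A⟩).2 =
      e.toContinuousLinearMap.comp (A.comp e.symm.toContinuousLinearMap) := by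
    intro A
    rw [Trivialization.coe_continuousLinearEquivAt_eq',
      Trivialization.symm_continuousLinearEquivAt_eq']
    rfl
  refine (he _).trans (endContraction_conj e fun A => ?_).symm
  rw [← he]
  have h1 : (trivializationAt (W →L[ℂ] W) (EndBundle E) p₀).symmL ℂ p A =
      e.symm.toContinuousLinearMap.comp (A.comp e.toContinuousLinearMap) := by
    rw [endBundle_symmL_eq p₀ hp, Trivialization.coe_continuousLinearEquivAt_eq',
      Trivialization.symm_continuousLinearEquivAt_eq']
  rw [← h1]
  exact congrArg (fun T : (W →L[ℂ] W) →L[ℂ] (W →L[ℂ] W) => T A)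
    (rfl : _ = ((trivializationAt (W →L[ℂ] W) (EndBundle E) p₀).continuousLinearMapAt ℂ p).comp
      (η.comp ((trivializationAt (W →L[ℂ] W) (EndBundle E) p₀).symmL ℂ p))) |>.trans
    (congrFun (Trivialization.coe_linearMapAt_of_mem (R := ℂ)
      (trivializationAt (W →L[ℂ] W) (EndBundle E) p₀) ⟨hp, hp⟩) _)

end Holomorphic

end

noncomputable section

open Filter Topology MeasureTheory

/-! ### Vanishing of the harmonic projection -/

section Final

variable {n m : ℕ} {X S : Type*} [TopologicalSpace X] [ChartedSpace (Fin n → ℂ) X]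
  [IsManifold 𝓘(ℂ, Fin n → ℂ) ω X]
  [TopologicalSpace S] [ChartedSpace (Fin m → ℂ) S]
  {W : Type*} [NormedAddCommGroup W] [NormedSpace ℂ W]
  {E : X × S → Type*} [TopologicalSpace (TotalSpace W E)]
  [∀ p, AddCommGroup (E p)] [∀ p, Module ℂ (E p)] [∀ p, TopologicalSpace (E p)]
  [FiberBundle W E]

section Zero

variable [VectorBundle ℂ W E] {g : TangentForm n X} {h : SesqForm E} {s : S}

theorem localSection_zero (x : X) :
    localSection W s (fun _ => (0 : E (_, s))) x =ᶠ[𝓝 (chartAt (Fin n → ℂ) x x)] fun _ => (0 : W) := by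
  have hc : ContinuousAt (chartAt (Fin n → ℂ) x).symm (chartAt (Fin n → ℂ) x x) :=
    (chartAt (Fin n → ℂ) x).symm.continuousAt (mem_chart_target _ x)
  have h0 : (chartAt (Fin n → ℂ) x).symm (chartAt (Fin n → ℂ) x x) = x :=
    (chartAt (Fin n → ℂ) x).left_inv (mem_chart_source _ x)
  have h1 := hc.eventually (p := fun y => (y, s) ∈ (trivializationAt W E (x, s)).baseSet)
    (by rw [h0]; exact eventually_mem_baseSet_fibre x)
  filter_upwards [h1] with z hz
  exact congrArg Prod.snd (Trivialization.zeroSection ℂ (trivializationAt W E (x, s)) hz)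

theorem dbarSection_zero (x : X) (β : Fin n) :
    dbarSection W s (fun _ => (0 : E (_, s))) x β = 0 := by
  rw [dbarSection_eq, dBar_congr (localSection_zero x), ← Trivialization.symmL_apply (R := ℂ) _
    (mem_baseSet_trivializationAt W E (x, s))]
  simp [dBar]

theorem isSmoothSection_zero : IsSmoothSection n m W s (fun _ : X => (0 : E (_, s))) := by
  intro x
  refine contMDiffAt_totalSpace.2 ⟨contMDiffAt_id.prodMk contMDiffAt_const, ?_⟩
  refine (contMDiffAt_const (c := (0 : W))).congr_of_eventuallyEq ?_
  filter_upwards [eventually_mem_baseSet_fibre (W := W) (E := E) (s := s) x] with y hy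
  exact congrArg Prod.snd (Trivialization.zeroSection ℂ (trivializationAt W E (x, s)) hy)

variable [CompactSpace X] [T2Space X]

theorem l2Product_eq_zero {q : ℕ} {ξ η : ∀ x : X, (Fin q → Fin n) → E (x, s)}
    (h0 : ∀ x b a, h (x, s) (ξ x b) (η x a) = 0) : l2Product g h s ξ η = 0 := by
  simp [l2Product, kaehlerIntegral, h0]

theorem isHarmonicSection_zero :
    IsHarmonicSection m W g h s (fun _ => (0 : E (_, s))) :=
  ⟨isSmoothSection_zero, isSmoothSection_zero, fun ζ _ =>
    (l2Product_eq_zero fun x _ _ => by rw [map_zero]; rfl).trans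
      (l2Product_eq_zero fun x _ _ => by rw [dbarSection_zero, map_zero]; rfl).symm⟩

/-- If `τ` is pointwise orthogonal to the harmonic sections, then its harmonic projection is zero. -/
theorem isHarmonicProjection_iff_eq_zero [FiniteDimensional ℂ W]
    (hg : IsHermitianMetric (W := Fin n → ℂ) 𝓘(ℝ, Fin n → ℂ) g)
    (hh : IsHermitianMetric (W := W) (𝓘(ℝ, Fin n → ℂ).prod 𝓘(ℝ, Fin m → ℂ)) h)
    {τ : ∀ x : X, E (x, s)}
    (hτ : ∀ η : ∀ x : X, E (x, s), IsHarmonicSection m W g h s η → ∀ x, h (x, s) (τ x) (η x) = 0)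
    (σ : ∀ x : X, E (x, s)) : IsHarmonicProjection m W g h s τ σ ↔ ∀ x, σ x = 0 := by
  constructor
  · rintro ⟨h1, h2⟩ x
    refine eq_zero_of_l2Section_self_eq_zero hg hh h1.1 ?_ x
    -- The projection `σ` is itself harmonic, hence an admissible test section. As `τ` is orthogonal
    -- to it, `⟨τ - σ, σ⟩ = 0` reduces to `‖σ‖² = 0`.
    have h3 := h2 σ h1
    rw [l2Section_eq] at h3 ⊢
    have h4 : (fun x => h (x, s) (τ x - σ x) (σ x)) = fun x => -h (x, s) (σ x) (σ x) := by
      funext x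
      rw [map_sub, LinearMap.sub_apply, hτ σ h1, zero_sub]
    rw [h4] at h3
    simpa [kaehlerIntegral, MeasureTheory.integral_neg, finsum_neg_distrib] using h3
  · intro h0
    obtain rfl : σ = fun _ => 0 := funext h0
    refine ⟨isHarmonicSection_zero, fun η hη => l2Product_eq_zero fun x _ _ => ?_⟩
    simpa using hτ η hη x

end Zero

variable [VectorBundle ℂ W E] [FiniteDimensional ℂ W]
  [∀ p, IsTopologicalAddGroup (E p)] [∀ p, ContinuousSMul ℂ (E p)]
  {g : TangentForm n X} {h : SesqForm E} {s : S}

set_option synthInstance.maxHeartbeats 400000 in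
theorem contMDiffVectorBundle_endBundle
    [ContMDiffVectorBundle ω W E (𝓘(ℂ, Fin n → ℂ).prod 𝓘(ℂ, Fin m → ℂ))] :
    ContMDiffVectorBundle ω (W →L[ℂ] W) (EndBundle E) (𝓘(ℂ, Fin n → ℂ).prod 𝓘(ℂ, Fin m → ℂ)) :=
  inferInstance

set_option synthInstance.maxHeartbeats 400000 in
/-- The contraction of a holomorphic section of `End (End E_s)` is holomorphic. -/
theorem isHolomorphicSection_endContraction [∀ p, T2Space (E p)] [∀ p, FiniteDimensional ℂ (E p)]
    {η : ∀ x : X, EndBundle (EndBundle E) (x, s)}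
    (hc : IsSmoothSection n m ((W →L[ℂ] W) →L[ℂ] (W →L[ℂ] W)) (E := EndBundle (EndBundle E)) s η)
    (hd : ∀ x, DifferentiableAt ℂ (localSection ((W →L[ℂ] W) →L[ℂ] (W →L[ℂ] W))
      (E := EndBundle (EndBundle E)) s η x) (chartAt (Fin n → ℂ) x x)) :
    IsHolomorphicSection n m (W →L[ℂ] W) (E := EndBundle E) s fun x => endContraction (η x) := by
  -- The contraction on the typical fibre: in a trivialization the contracted section is `κ` applied
  -- to the local representative of `η`.
  let κ := LinearMap.toContinuousLinearMap (endContraction (T := W))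
  refine isHolomorphicSection_of_differentiableAt (fun x => ?_) fun x => ?_
  · have h1 : ContinuousAt (fun y => (trivializationAt ((W →L[ℂ] W) →L[ℂ] (W →L[ℂ] W))
      (EndBundle (EndBundle E)) (x, s) ⟨(y, s), η y⟩).2) x :=
      (contMDiffAt_totalSpace.1 (hc x)).2.continuousAt
    refine (κ.continuous.continuousAt.comp h1).congr ?_
    filter_upwards [eventually_mem_baseSet_fibre (W := W) (E := E) (s := s) x] with y hy
    exact (endContraction_trivializationAt (x, s) hy (η y)).symm
  · refine (DifferentiableAt.comp (E := Fin n → ℂ) (F := (W →L[ℂ] W) →L[ℂ] (W →L[ℂ] W))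
      (G := W →L[ℂ] W) _ κ.differentiableAt (hd x)).congr_of_eventuallyEq ?_
    have hc : ContinuousAt (chartAt (Fin n → ℂ) x).symm (chartAt (Fin n → ℂ) x x) :=
      (chartAt (Fin n → ℂ) x).symm.continuousAt (mem_chart_target _ x)
    have h0 : (chartAt (Fin n → ℂ) x).symm (chartAt (Fin n → ℂ) x x) = x :=
      (chartAt (Fin n → ℂ) x).left_inv (mem_chart_source _ x)
    have h1 := hc.eventually (p := fun y => (y, s) ∈ (trivializationAt W E (x, s)).baseSet)
      (by rw [h0]; exact eventually_mem_baseSet_fibre x)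
    filter_upwards [h1] with z hz
    exact endContraction_trivializationAt (x, s) hz (η _)

set_option synthInstance.maxHeartbeats 400000 in
/-- If `E_s` is simple, then the harmonic sections of `End (End E_s)` are pointwise orthogonal to
the inner derivations. -/
theorem endForm_endForm_eq_zero_of_isHarmonicSection [CompactSpace X] [T2Space X]
    [ContMDiffVectorBundle ω W E (𝓘(ℂ, Fin n → ℂ).prod 𝓘(ℂ, Fin m → ℂ))]
    (hg : IsHermitianMetric (W := Fin n → ℂ) 𝓘(ℝ, Fin n → ℂ) g)
    (hh : IsHermitianMetric (W := W) (𝓘(ℝ, Fin n → ℂ).prod 𝓘(ℝ, Fin m → ℂ)) h)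
    (hs : IsSimpleFibre n m W E s) {η : ∀ x : X, EndBundle (EndBundle E) (x, s)}
    (hη : IsHarmonicSection m ((W →L[ℂ] W) →L[ℂ] (W →L[ℂ] W)) (E := EndBundle (EndBundle E)) g
      (endForm (W →L[ℂ] W) (E := EndBundle E) (endForm W h)) s η) {x : X}
    {R : E (x, s) →L[ℂ] E (x, s)} {P : EndBundle (EndBundle E) (x, s)}
    (hP : ∀ A, P A = adLinear R A) :
    endForm (W →L[ℂ] W) (E := EndBundle E) (endForm W h) (x, s) P (η x) = 0 := by
  have : ∀ p, T2Space (E p) := fun p =>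
    t2Space_fibre (trivializationAt W E p) (mem_baseSet_trivializationAt W E p)
  have : ∀ p, FiniteDimensional ℂ (E p) := finiteDimensional_fibre (Module.finBasis ℂ W)
  have hE : ContMDiffVectorBundle ω (W →L[ℂ] W) (EndBundle E)
      (𝓘(ℂ, Fin n → ℂ).prod 𝓘(ℂ, Fin m → ℂ)) := contMDiffVectorBundle_endBundle
  have hEE : ContMDiffVectorBundle ω ((W →L[ℂ] W) →L[ℂ] (W →L[ℂ] W)) (EndBundle (EndBundle E))
      (𝓘(ℂ, Fin n → ℂ).prod 𝓘(ℂ, Fin m → ℂ)) :=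
    contMDiffVectorBundle_endBundle (W := W →L[ℂ] W) (E := EndBundle E)
  have hH := isHermitianMetric_endForm (W := W →L[ℂ] W) (E := EndBundle E)
    (isHermitianMetric_endForm hh)
  -- Simplicity enters here: the contraction of `η` is a holomorphic endomorphism of `E_s`, hence a
  -- scalar.
  obtain ⟨c, hc⟩ := hs _ (isHolomorphicSection_endContraction hη.1
    (IsHarmonicSection.differentiableAt_localSection
      (W := (W →L[ℂ] W) →L[ℂ] (W →L[ℂ] W)) (E := EndBundle (EndBundle E)) hEE hg hH hη))
  exact endForm_endForm_eq_zero (hh.isPosHermitian (x, s)) hP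
    (trace_adLinear_comp_eq_zero (hc x))

theorem baseCurvature_endForm
    (hh : IsHermitianMetric (W := W) (𝓘(ℝ, Fin n → ℂ).prod 𝓘(ℝ, Fin m → ℂ)) h)
    (v w : TangentSpace 𝓘(ℂ, Fin m → ℂ) s) (x : X) (A : E (x, s) →L[ℂ] E (x, s)) :
    baseCurvature n (W →L[ℂ] W) (E := EndBundle E) (endForm W h) s v w x A =
      adLinear (baseCurvature n W h s v w x) A :=
  chernCurvature_endForm hh.isPosHermitian (contDiffAt_localForm hh (x, s)) A

theorem trace_baseCurvature_endForm
    (hh : IsHermitianMetric (W := W) (𝓘(ℝ, Fin n → ℂ).prod 𝓘(ℝ, Fin m → ℂ)) h)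
    (v w : TangentSpace 𝓘(ℂ, Fin m → ℂ) s) (x : X) :
    LinearMap.trace ℂ (EndBundle E (x, s))
      (baseCurvature n (W →L[ℂ] W) (E := EndBundle E) (endForm W h) s v w x).toLinearMap = 0 := by
  have : T2Space (E (x, s)) :=
    t2Space_fibre (trivializationAt W E (x, s)) (mem_baseSet_trivializationAt W E (x, s))
  have : FiniteDimensional ℂ (E (x, s)) := finiteDimensional_fibre (Module.finBasis ℂ W) _
  exact (congrArg _ (LinearMap.ext (baseCurvature_endForm hh v w x))).trans (trace_adLinear _)

set_option synthInstance.maxHeartbeats 400000 in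
theorem isHermiteEinstein_endForm
    (hh : IsHermitianMetric (W := W) (𝓘(ℝ, Fin n → ℂ).prod 𝓘(ℝ, Fin m → ℂ)) h)
    (hHE : IsHermiteEinstein m W g h s) :
    IsHermiteEinstein m (W →L[ℂ] W) (E := EndBundle E) g (endForm W h) s := by
  obtain ⟨l, hl⟩ := hHE
  -- The Einstein constant of the endomorphism bundle is `0`, because `ad` annihilates `λ · id`.
  refine ⟨0, fun x => ContinuousLinearMap.ext fun A => ?_⟩
  have h1 := fun u v => chernCurvature_endForm (u := u) (w := v) hh.isPosHermitian
    (contDiffAt_localForm hh (x, s)) A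
  have h2 := congrArg (fun R => adLinear R A) (hl x)
  simp only [map_sum, map_smul, LinearMap.sum_apply, LinearMap.smul_apply, adLinear_id,
    LinearMap.zero_apply, smul_zero] at h2
  simp only [_root_.sum_apply, _root_.smul_apply, Complex.ofReal_zero, zero_smul]
  refine Eq.trans ?_ h2
  exact Finset.sum_congr rfl fun α _ => Finset.sum_congr rfl fun β _ => by rw [h1]; rfl

set_option synthInstance.maxHeartbeats 400000 in
/-- If `E_s` is simple, then the harmonic projection of the curvature of `End E_s` is zero. -/
theorem isHarmonicCurvatureTerm_endForm_iff [CompactSpace X] [T2Space X]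
    [ContMDiffVectorBundle ω W E (𝓘(ℂ, Fin n → ℂ).prod 𝓘(ℂ, Fin m → ℂ))]
    (hg : IsHermitianMetric (W := Fin n → ℂ) 𝓘(ℝ, Fin n → ℂ) g)
    (hh : IsHermitianMetric (W := W) (𝓘(ℝ, Fin n → ℂ).prod 𝓘(ℝ, Fin m → ℂ)) h)
    (hs : IsSimpleFibre n m W E s) {v w : TangentSpace 𝓘(ℂ, Fin m → ℂ) s}
    (σ : ∀ x : X, EndBundle (EndBundle E) (x, s)) :
    IsHarmonicCurvatureTerm m (W →L[ℂ] W) (E := EndBundle E) g (endForm W h) s v w σ ↔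
      ∀ x, σ x = 0 :=
  isHarmonicProjection_iff_eq_zero
    (W := (W →L[ℂ] W) →L[ℂ] (W →L[ℂ] W)) (E := EndBundle (EndBundle E)) (m := m) (s := s) hg
    (isHermitianMetric_endForm (W := W →L[ℂ] W) (E := EndBundle E) (isHermitianMetric_endForm hh))
    (fun _ hη x => endForm_endForm_eq_zero_of_isHarmonicSection hg hh hs hη
      (baseCurvature_endForm hh v w x)) σ

end Final

end

theorem proposition3 {n m : ℕ}
    {X : Type*} [TopologicalSpace X] [CompactSpace X] [T2Space X] [ChartedSpace (Fin n → ℂ) X]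
    [IsManifold 𝓘(ℂ, Fin n → ℂ) ω X]
    (g : TangentForm n X)
    (hg : IsHermitianMetric (W := Fin n → ℂ) 𝓘(ℝ, Fin n → ℂ) g) (hK : IsKaehler g)
    {S : Type*} [TopologicalSpace S] [ChartedSpace (Fin m → ℂ) S]
    [IsManifold 𝓘(ℂ, Fin m → ℂ) ω S]
    {V : Type*} [NormedAddCommGroup V] [NormedSpace ℂ V] [FiniteDimensional ℂ V]
    {F : X × S → Type*} [TopologicalSpace (TotalSpace V F)]
    [∀ p, AddCommGroup (F p)] [∀ p, Module ℂ (F p)] [∀ p, TopologicalSpace (F p)]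
    [∀ p, IsTopologicalAddGroup (F p)] [∀ p, ContinuousSMul ℂ (F p)]
    [FiberBundle V F] [VectorBundle ℂ V F]
    [ContMDiffVectorBundle ω V F (𝓘(ℂ, Fin n → ℂ).prod 𝓘(ℂ, Fin m → ℂ))]
    (h : SesqForm F)
    (hh : IsHermitianMetric (W := V) (𝓘(ℝ, Fin n → ℂ).prod 𝓘(ℝ, Fin m → ℂ)) h)
    (hHE : ∀ s : S, IsHermiteEinstein m V g h s)
    (hsimple : ∀ s : S, IsSimpleFibre n m V F s) :
    -- the induced metrics on the endomorphism bundles are hermitian and Hermite-Einstein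
    IsHermitianMetric (W := V →L[ℂ] V) (E := EndBundle F)
        (𝓘(ℝ, Fin n → ℂ).prod 𝓘(ℝ, Fin m → ℂ)) (endForm V h) ∧
    (∀ s : S, IsHermiteEinstein m (V →L[ℂ] V) (E := EndBundle F) g (endForm V h) s) ∧
    ∀ (s : S) (v w : TangentSpace 𝓘(ℂ, Fin m → ℂ) s),
      -- the trace of the induced curvature vanishes
      (∀ x : X, LinearMap.trace ℂ (EndBundle F (x, s))
        (baseCurvature n (V →L[ℂ] V) (E := EndBundle F) (endForm V h) s v w x).toLinearMap = 0) ∧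
      -- the harmonic projection of the curvature term of the family of endomorphism bundles
      -- exists, namely it is zero, and zero is its only value
      IsHarmonicCurvatureTerm m (V →L[ℂ] V) (E := EndBundle F) g (endForm V h) s v w
        (fun _ => 0) ∧
      ∀ σ : ∀ x : X, EndBundle (EndBundle F) (x, s),
        IsHarmonicCurvatureTerm m (V →L[ℂ] V) (E := EndBundle F) g (endForm V h) s v w σ →
          (∀ x, σ x = 0) ∧
          -- so the induced term in the curvature formula vanishes in every degree `q`
          ∀ (q : ℕ) (ξ η : ∀ x : X, (Fin q → Fin n) → EndBundle F (x, s)),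
            l2Product g (endForm V h) s (fun x b => σ x (ξ x b)) η = 0 := by
  refine ⟨isHermitianMetric_endForm hh, fun s => isHermiteEinstein_endForm hh (hHE s), fun s v w => ?_⟩
  have hzero := fun σ => isHarmonicCurvatureTerm_endForm_iff (v := v) (w := w) hg hh (hsimple s) σ
  refine ⟨fun x => ?_, (hzero _).2 fun _ => rfl, fun σ hσ => ?_⟩
  · exact trace_baseCurvature_endForm hh v w x
  · have h0 := (hzero σ).1 hσ
    refine ⟨h0, fun q ξ η => l2Product_eq_zero fun x b a => ?_⟩
    rw [h0 x, _root_.zero_apply, map_zero]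
    rfl
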